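/- Let $Z\in\mathbb{R}^{(d+1)\times(d+1)}$ be the lower shift matrix. For $G\in\mathbb{R}^{(d+1)\times 2}$ consider the following algorithm. Put $G_0=G$; for $k=0,1,\dots,d$ compute a right QR decomposition $G_k=R_kQ_k$ with $Q_k$ a $2\times2$ orthogonal matrix (a plane rotation or a Householder reflection; $Q_k=I$ if row $k$ of $G_k$ is zero) such that row $k$ of $R_k=[\mathbf{u}_k,\mathbf{v}_k]$ has the form $[*,0]$, let column $k$ of $L$ be $\mathbf{u}_k/u_{k,k}$, and put $G_{k+1}=[Z\mathbf{u}_k,\mathbf{v}_k]$. Quantities with a hat are those computed when the algorithm is executed in floating point arithmetic of machine precision $\epsilon_{\mathrm{ma}}$, i.e. when every operation $+,-,\times,/,\sqrt{\cdot}$ is carried out with a relative error of at most $\epsilon_{\mathrm{ma}}$; $\hat u_{k,k}$ is entry $k$ of the computed $\hat{\mathbf u}_k$, and $\hat H=\mathrm{diag}(\hat u_{0,0},\dots,\hat u_{d,d})$. The algorithm breaks down if some $\hat u_{k,k}$ is $0$. Let $\|\cdot\|_F$ be the Frobenius norm. There are absolute constants $C,c>0$ such that the following holds for all $d\ge 1$,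 every floating point arithmetic of precision $\epsilon_{\mathrm{ma}}$, and either choice of the QR decomposition. Let $G\in\mathbb{R}^{(d+1)\times 2}$ and let $K$ satisfy $K-ZKZ^T=GG^T$. (a) (Backward error.) If $d\,\epsilon_{\mathrm{ma}}\le c$ and the algorithm does not break down, then $$\|\hat L\hat H^2\hat L^T-K\|_F\le C\,d^3\,\|G\|_F^2\,\epsilon_{\mathrm{ma}} .$$ (b) (Forward error.) Let $\eta>0$ be such that all eigenvalues of $K$ lie in $[1,\eta^{-1}]$, and suppose that $d^3\eta^{-1/2}\|G\|_F^2\,\epsilon_{\mathrm{ma}}\le c$. Then the algorithm does not break down, and if $K=LDL^T$ is the LDL decomposition of $K$ ($L$ unit lower triangular, $D$ diagonal), then $$\|\hat L-L\|_F\le C\,d^3\,\eta^{-1}\,\|G\|_F^2\,\epsilon_{\mathrm{ma}} .$$ (c) (Forward error for quantum signal processing.) Let $0<\eta<1$ and let $f$ be an even real polynomial of degree at most $2d$ with $|f|\le 1-\eta$ on $[-1,1]$. Put $b(z)=\mathrm{i}f(\cos\theta)$ for $z=e^{2\mathrm{i}\theta}$, and let $a$ be the polynomial in $z^{-1}$ that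 has no zeros in $|z|>1$, satisfies $a(\infty)>0$, and satisfies $|a|^2+|b|^2=1$ on $|z|=1$. Let $c_k$ be the coefficient of $z^k$ in the Laurent series of $b/a$ on $|z|=1$ (these are purely imaginary), let $\mathbf p=-\mathrm{i}(c_d,\dots,c_0)^T\in\mathbb{R}^{d+1}$, let $B$ be the lower triangular Toeplitz matrix with first column $\mathbf p$, and put $G=[\mathbf e_0,\mathbf p]$ with $\mathbf e_0=(1,0,\dots,0)^T$, and $K=I+BB^T$. If $d^3\eta^{-1/2}\|G\|_F^2\,\epsilon_{\mathrm{ma}}\le c$, then the conclusion of (b) holds. -/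

import Mathlib

/- Matrix norms below are Frobenius norms. -/
attribute [local instance] Matrix.frobeniusNormedAddCommGroup

namespace HalfCholesky

open Matrix

/-- The standard model of floating point arithmetic with machine precision `ε`: each of the five
elementary operations returns the exact result up to a relative error of at most `ε`.
The operations are total functions on `ℝ`: operations given only on a set of machine numbers
can be extended by the exact ones. Nothing is assumed about division by zero or
about square roots of negative numbers. -/
structure FloatArith (ε : ℝ) where
  add : ℝ → ℝ → ℝ
  sub : ℝ → ℝ → ℝ
  mul : ℝ → ℝ → ℝ
  div : ℝ → ℝ → ℝ
  sqrt : ℝ → ℝ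
  add_err : ∀ x y, ∃ δ : ℝ, |δ| ≤ ε ∧ add x y = (x + y) * (1 + δ)
  sub_err : ∀ x y, ∃ δ : ℝ, |δ| ≤ ε ∧ sub x y = (x - y) * (1 + δ)
  mul_err : ∀ x y, ∃ δ : ℝ, |δ| ≤ ε ∧ mul x y = (x * y) * (1 + δ)
  div_err : ∀ x y, y ≠ 0 → ∃ δ : ℝ, |δ| ≤ ε ∧ div x y = (x / y) * (1 + δ)
  sqrt_err : ∀ x, 0 ≤ x → ∃ δ : ℝ, |δ| ≤ ε ∧ sqrt x = Real.sqrt x * (1 + δ)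

/-- The lower shift matrix `Z`. -/
def lowerShift (d : ℕ) : Matrix (Fin (d + 1)) (Fin (d + 1)) ℝ :=
  Matrix.of fun i j => if (i : ℕ) = (j : ℕ) + 1 then 1 else 0

section Algorithm

variable {ε : ℝ} (A : FloatArith ε) {d : ℕ}

/-- The computed length of the vector `(a, b)`. -/
def flLength (a b : ℝ) : ℝ := A.sqrt (A.add (A.mul a a) (A.mul b b))

/-- Right QR decomposition `G = R Q` with pivot row `k`, by a plane rotation `Q ∈ SO(2)`:
the computed `R`, whose row `k` has the form `[*, 0]`. -/
def rotationQR (k : Fin (d + 1)) (G : Matrix (Fin (d + 1)) (Fin 2) ℝ) :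
    Matrix (Fin (d + 1)) (Fin 2) ℝ :=
  let a := G k 0
  let b := G k 1
  let r := flLength A a b
  let co := A.div a r
  let si := A.div b r
  Matrix.of fun i =>
    if i = k then ![r, 0]
    else ![A.add (A.mul co (G i 0)) (A.mul si (G i 1)),
           A.sub (A.mul co (G i 1)) (A.mul si (G i 0))]

/-- Right QR decomposition `G = R Q` with pivot row `k`, by a Householder reflection
`Q = I - β w wᵀ`, where `w = (a + σ, b)`, `σ = ± ‖(a, b)‖` has the sign of `a`,
and `β = 2 / ‖w‖² = 1 / (σ (a + σ))`: the computed `R`, whose row `k` is `[-σ, 0]`. -/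
noncomputable def householderQR (k : Fin (d + 1)) (G : Matrix (Fin (d + 1)) (Fin 2) ℝ) :
    Matrix (Fin (d + 1)) (Fin 2) ℝ :=
  let a := G k 0
  let b := G k 1
  let σ := if 0 ≤ a then flLength A a b else -flLength A a b
  let w := A.add a σ
  let β := A.div 1 (A.mul σ w)
  Matrix.of fun i =>
    if i = k then ![-σ, 0]
    else
      let t := A.mul β (A.add (A.mul w (G i 0)) (A.mul b (G i 1)))
      ![A.sub (G i 0) (A.mul t w), A.sub (G i 1) (A.mul t b)]

/-- The two standard ways to carry out the right QR decomposition. -/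
inductive QRMethod where
  | rotation
  | householder

/-- The computed factor `R` of the right QR decomposition `G = R Q` with pivot row `k`.
If the pivot row vanishes already, then `Q = I`. -/
noncomputable def qrFactor (m : QRMethod) (k : Fin (d + 1)) (G : Matrix (Fin (d + 1)) (Fin 2) ℝ) :
    Matrix (Fin (d + 1)) (Fin 2) ℝ :=
  if G k 0 = 0 ∧ G k 1 = 0 then G
  else match m with
    | .rotation => rotationQR A k G
    | .householder => householderQR A k G

/-- One pass `G_k ↦ G_{k+1} = [Z u_k, v_k]` of the loop, where `R_k = [u_k, v_k]`.
The shift only moves data and is free of rounding errors. -/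
noncomputable def nextGenerator (m : QRMethod) (k : Fin (d + 1)) (G : Matrix (Fin (d + 1)) (Fin 2) ℝ) :
    Matrix (Fin (d + 1)) (Fin 2) ℝ :=
  let R := qrFactor A m k G
  Matrix.of fun i => ![(lowerShift d *ᵥ fun j => R j 0) i, R i 1]

/-- The computed generators `Ĝ_0 = G, Ĝ_1, …` (only the indices `k ≤ d` are used). -/
noncomputable def generator (m : QRMethod) (G : Matrix (Fin (d + 1)) (Fin 2) ℝ) :
    ℕ → Matrix (Fin (d + 1)) (Fin 2) ℝ
  | 0 => G
  | k + 1 => nextGenerator A m (Fin.ofNat (d + 1) k) (generator m G k)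

/-- The computed matrix `Û = [û_0, …, û_d]`, where `û_k` is the first column of `R̂_k`. -/
noncomputable def computedU (m : QRMethod) (G : Matrix (Fin (d + 1)) (Fin 2) ℝ) :
    Matrix (Fin (d + 1)) (Fin (d + 1)) ℝ :=
  Matrix.of fun i k => qrFactor A m k (generator A m G k) i 0

/-- The computed factor `L̂`: its column `k` is `û_k` divided by `û_{kk}`. -/
noncomputable def computedL (m : QRMethod) (G : Matrix (Fin (d + 1)) (Fin 2) ℝ) :
    Matrix (Fin (d + 1)) (Fin (d + 1)) ℝ :=
  Matrix.of fun i k => A.div (computedU A m G i k) (computedU A m G k k)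

/-- The diagonal matrix `Ĥ = diag(û_{00}, …, û_{dd})`. -/
noncomputable def computedH (m : QRMethod) (G : Matrix (Fin (d + 1)) (Fin 2) ℝ) :
    Matrix (Fin (d + 1)) (Fin (d + 1)) ℝ :=
  Matrix.diagonal fun k => computedU A m G k k

/-- The algorithm runs to completion: no division by zero occurs when `L̂` is formed. -/
def NoBreakdown (m : QRMethod) (G : Matrix (Fin (d + 1)) (Fin 2) ℝ) : Prop :=
  ∀ k, computedU A m G k k ≠ 0

end Algorithm

/-- `K = L D Lᵀ` is the LDL decomposition of `K`, with `L` unit lower triangular and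
`D = diag(δ_0, …, δ_d)`. -/
def IsLDL {d : ℕ} (K L : Matrix (Fin (d + 1)) (Fin (d + 1)) ℝ) (δ : Fin (d + 1) → ℝ) : Prop :=
  (∀ i, L i i = 1) ∧ (∀ i j, i < j → L i j = 0) ∧ K = L * Matrix.diagonal δ * Lᵀ

/-- `f` is an even real polynomial of degree at most `2 d` with `|f| ≤ 1 - η` on `[-1, 1]`. -/
def IsTarget (d : ℕ) (η : ℝ) (f : Polynomial ℝ) : Prop :=
  f.natDegree ≤ 2 * d ∧ f.comp (-Polynomial.X) = f ∧ ∀ x ∈ Set.Icc (-1 : ℝ) 1, |f.eval x| ≤ 1 - η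

/-- With `z = e^{it}` and `b(z) = i f(cos (t/2))`, the function `a(z) = P(1/z)`, a polynomial in
`1/z`, is the outer function on `{|z| > 1} ∪ {∞}` with `a(∞) > 0` and
`a a* + b b* = 1` on the unit circle. (A polynomial is outer on the unit disk if and only if it has
no zero there.) -/
def IsOuterComplement (f : Polynomial ℝ) (P : Polynomial ℂ) : Prop :=
  (∀ w : ℂ, ‖w‖ < 1 → P.eval w ≠ 0) ∧
  ((P.eval 0).im = 0 ∧ 0 < (P.eval 0).re) ∧
  ∀ t : ℝ, ‖P.eval (Complex.exp (-(t * Complex.I)))‖ ^ 2 + (f.eval (Real.cos (t / 2))) ^ 2 = 1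

/-- The coefficient `c_k` of `z^k` in the Laurent series of `b / a` on the unit circle. -/
noncomputable def laurentCoeff (f : Polynomial ℝ) (P : Polynomial ℂ) (k : ℤ) : ℂ :=
  (1 / (2 * Real.pi) : ℝ) *
    ∫ t in (0 : ℝ)..(2 * Real.pi),
      Complex.I * (f.eval (Real.cos (t / 2)) : ℝ) / P.eval (Complex.exp (-(t * Complex.I))) *
        Complex.exp (-(k * t * Complex.I))

/-- The vector `p = -i (c_d, …, c_0)ᵀ`. The coefficients `c_k` are purely imaginary, so `p` is real,
and taking real parts changes nothing but the type. -/
noncomputable def pVec (d : ℕ) (f : Polynomial ℝ) (P : Polynomial ℂ) : Fin (d + 1) → ℝ :=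
  fun j => (-Complex.I * laurentCoeff f P ((d : ℤ) - (j : ℤ))).re

/-- The lower triangular Toeplitz matrix with first column `p`. -/
def lowerToeplitz {d : ℕ} (p : Fin (d + 1) → ℝ) : Matrix (Fin (d + 1)) (Fin (d + 1)) ℝ :=
  Matrix.of fun i j => if j ≤ i then p (i - j) else 0

/-- The matrix `[e_0, p]`. -/
def startGenerator {d : ℕ} (p : Fin (d + 1) → ℝ) : Matrix (Fin (d + 1)) (Fin 2) ℝ :=
  Matrix.of fun i => ![if i = 0 then 1 else 0, p i]

end HalfCholesky

open HalfCholesky Matrix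

/-!
Let `∇ X = X - Z X Zᵀ`. Since `Z` is a contraction and `Z ^ (d + 1) = 0`, telescoping
`Zʲ (∇ X) (Zᵀ)ʲ` gives `‖X‖ ≤ (d + 1) ‖∇ X‖`. An exact right QR step does not change `G Gᵀ`, so a
computed step changes it by `O(ε ‖G‖²)`, and `∇ (Û Ûᵀ - K)` is the sum of these `d + 1` local
errors. This is the backward error, up to the roundings in `L̂ = Û Ĥ⁻¹`.

For the forward error write `K = V Vᵀ` with `V` lower triangular and put `E = Û Ûᵀ - K`. The
strictly lower triangular parts of `V⁻¹ E Û⁻ᵀ` and of `V⁻¹ Û` agree, and the latter determines the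
difference of the unit lower triangular factors. In the quantum signal processing case, `B` is a
section of the Toeplitz operator with symbol `b / (i a)`, and `|b / a|² = 1 / |a|² - 1 ≤ η⁻¹ - 1`.
-/

namespace HalfCholesky

section MatrixNorms

variable {l m n : Type*} [Fintype l] [Fintype m] [Fintype n]

lemma frobenius_sq (A : Matrix m n ℝ) : ‖A‖ ^ 2 = ∑ i, ∑ j, A i j ^ 2 := by
  rw [frobenius_norm_def, ← Real.sqrt_eq_rpow, Real.sq_sqrt (by positivity)]
  simp only [Real.norm_eq_abs, Real.rpow_ofNat, sq_abs]

lemma frobenius_le_of_row_le {A : Matrix m n ℝ} {B : Matrix m l ℝ} {s : ℝ} (hs : 0 ≤ s)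
    (h : ∀ i, ∑ j, A i j ^ 2 ≤ s ^ 2 * ∑ j, B i j ^ 2) : ‖A‖ ≤ s * ‖B‖ := by
  rw [← sq_le_sq₀ (norm_nonneg _) (by positivity), mul_pow, frobenius_sq, frobenius_sq,
    Finset.mul_sum]
  exact Finset.sum_le_sum fun i _ => h i

lemma frobenius_le_of_abs_le {A B : Matrix m n ℝ} {s : ℝ} (hs : 0 ≤ s)
    (h : ∀ i j, |A i j| ≤ s * |B i j|) : ‖A‖ ≤ s * ‖B‖ := by
  refine frobenius_le_of_row_le hs fun i => ?_
  rw [Finset.mul_sum]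
  refine Finset.sum_le_sum fun j _ => ?_
  rw [← mul_pow, sq_le_sq, abs_mul, abs_of_nonneg hs]
  exact h i j

lemma frobenius_eq_of_mul_transpose_eq {A B : Matrix m n ℝ} (h : A * Aᵀ = B * Bᵀ) :
    ‖A‖ = ‖B‖ := by
  rw [← sq_eq_sq₀ (norm_nonneg _) (norm_nonneg _), frobenius_sq, frobenius_sq]
  refine Finset.sum_congr rfl fun i _ => ?_
  simpa [Matrix.mul_apply, sq] using congrFun (congrFun h i) i

lemma norm_mul_transpose_sub_le (A B : Matrix m n ℝ) :
    ‖A * Aᵀ - B * Bᵀ‖ ≤ ‖A - B‖ * (‖A - B‖ + 2 * ‖B‖) := by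
  have hsplit : A * Aᵀ - B * Bᵀ = (A - B) * (A - B)ᵀ + (A - B) * Bᵀ + B * (A - B)ᵀ := by
    simp only [transpose_sub, Matrix.mul_sub, Matrix.sub_mul]
    abel
  have hmul (X Y : Matrix m n ℝ) : ‖X * Yᵀ‖ ≤ ‖X‖ * ‖Y‖ :=
    (frobenius_norm_mul X Yᵀ).trans_eq (by rw [frobenius_norm_transpose])
  calc ‖A * Aᵀ - B * Bᵀ‖
      ≤ ‖(A - B) * (A - B)ᵀ‖ + ‖(A - B) * Bᵀ‖ + ‖B * (A - B)ᵀ‖ := hsplit ▸ norm_add₃_le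
    _ ≤ ‖A - B‖ * ‖A - B‖ + ‖A - B‖ * ‖B‖ + ‖B‖ * ‖A - B‖ := by gcongr <;> apply hmul
    _ = ‖A - B‖ * (‖A - B‖ + 2 * ‖B‖) := by ring

/-- The spectral norm of a matrix, i.e. its operator norm for the Euclidean norms. It gets a name of
its own because `‖A‖` is the Frobenius norm here. -/
noncomputable def l2OpNorm [DecidableEq n] (A : Matrix m n ℝ) : ℝ :=
  ‖LinearMap.toContinuousLinearMap (toEuclideanLin A)‖

lemma l2OpNorm_nonneg [DecidableEq n] (A : Matrix m n ℝ) : 0 ≤ l2OpNorm A := norm_nonneg _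

lemma dotProduct_self_eq_norm_sq (x : n → ℝ) : x ⬝ᵥ x = ‖WithLp.toLp 2 x‖ ^ 2 := by
  rw [EuclideanSpace.real_norm_sq_eq, dotProduct]
  simp only [sq]

lemma mulVec_dotProduct_self_le [DecidableEq n] (A : Matrix m n ℝ) (x : n → ℝ) :
    (A *ᵥ x) ⬝ᵥ (A *ᵥ x) ≤ l2OpNorm A ^ 2 * (x ⬝ᵥ x) := by
  rw [dotProduct_self_eq_norm_sq, dotProduct_self_eq_norm_sq, ← mul_pow]
  gcongr
  exact (LinearMap.toContinuousLinearMap (toEuclideanLin A)).le_opNorm (WithLp.toLp 2 x)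

lemma l2OpNorm_le_of_mulVec_dotProduct_self_le [DecidableEq n] {A : Matrix m n ℝ} {s : ℝ}
    (hs : 0 ≤ s) (h : ∀ x, (A *ᵥ x) ⬝ᵥ (A *ᵥ x) ≤ s ^ 2 * (x ⬝ᵥ x)) : l2OpNorm A ≤ s := by
  refine ContinuousLinearMap.opNorm_le_bound _ hs fun x => ?_
  have hx := h x.ofLp
  rw [dotProduct_self_eq_norm_sq, dotProduct_self_eq_norm_sq, ← mul_pow] at hx
  exact (sq_le_sq₀ (norm_nonneg _) (by positivity)).1 hx

lemma l2OpNorm_transpose [DecidableEq m] [DecidableEq n] (A : Matrix m n ℝ) :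
    l2OpNorm Aᵀ = l2OpNorm A :=
  l2_opNorm_conjTranspose A

lemma abs_apply_le_l2OpNorm [DecidableEq n] (A : Matrix m n ℝ) (i : m) (j : n) :
    |A i j| ≤ l2OpNorm A := by
  refine abs_le_of_sq_le_sq ?_ (l2OpNorm_nonneg A)
  have hj := mulVec_dotProduct_self_le A (Pi.single j 1)
  simp only [mulVec_single_one, dotProduct_single_one, Pi.single_eq_same, mul_one] at hj
  refine le_trans ?_ hj
  rw [sq]
  exact Finset.single_le_sum (f := fun i => A.col j i * A.col j i)
    (fun i _ => mul_self_nonneg _) (Finset.mem_univ i)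

lemma norm_mul_le_l2OpNorm_mul [DecidableEq m] (A : Matrix l m ℝ) (B : Matrix m n ℝ) :
    ‖A * B‖ ≤ l2OpNorm A * ‖B‖ := by
  rw [← frobenius_norm_transpose, ← frobenius_norm_transpose B]
  refine frobenius_le_of_row_le (l2OpNorm_nonneg A) fun j => ?_
  simpa only [dotProduct, mulVec, transpose_apply, Matrix.mul_apply, sq] using
    mulVec_dotProduct_self_le A fun i => B i j

lemma norm_mul_le_mul_l2OpNorm [DecidableEq n] (A : Matrix l m ℝ) (B : Matrix m n ℝ) :
    ‖A * B‖ ≤ ‖A‖ * l2OpNorm B := by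
  classical
  rw [← frobenius_norm_transpose, transpose_mul, mul_comm, ← l2OpNorm_transpose,
    ← frobenius_norm_transpose A]
  exact norm_mul_le_l2OpNorm_mul _ _

lemma abs_dotProduct_mulVec_le (A : Matrix n n ℝ) (x : n → ℝ) :
    |x ⬝ᵥ (A *ᵥ x)| ≤ ‖A‖ * (x ⬝ᵥ x) := by
  have hx : x ⬝ᵥ (A *ᵥ x) = ∑ p : n × n, A p.1 p.2 * (x p.1 * x p.2) := by
    simp only [dotProduct, mulVec, Finset.mul_sum, Fintype.sum_prod_type]
    exact Finset.sum_congr rfl fun i _ => Finset.sum_congr rfl fun j _ => by ring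
  have hxx : (x ⬝ᵥ x) ^ 2 = ∑ p : n × n, (x p.1 * x p.2) ^ 2 := by
    simp only [dotProduct, sq, Finset.sum_mul_sum, Fintype.sum_prod_type]
    exact Finset.sum_congr rfl fun i _ => Finset.sum_congr rfl fun j _ => by ring
  have hxx0 : 0 ≤ x ⬝ᵥ x := dotProduct_self_eq_norm_sq x ▸ sq_nonneg _
  refine abs_le_of_sq_le_sq ?_ (by positivity)
  rw [hx, mul_pow, hxx, frobenius_sq, ← Fintype.sum_prod_type' fun i j => A i j ^ 2]
  exact Finset.sum_mul_sq_le_sq_mul_sq _ _ _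

end MatrixNorms

section QuadraticForms

variable {m n : Type*} [Fintype m] [Fintype n]

lemma dotProduct_mul_transpose_mulVec (A : Matrix m n ℝ) (x : m → ℝ) :
    x ⬝ᵥ ((A * Aᵀ) *ᵥ x) = (Aᵀ *ᵥ x) ⬝ᵥ (Aᵀ *ᵥ x) := by
  rw [← mulVec_mulVec, dotProduct_mulVec, ← mulVec_transpose]

lemma posSemidef_sub_iff_dotProduct_mulVec_le {M N : Matrix n n ℝ} (hM : M.IsHermitian)
    (hN : N.IsHermitian) :
    (M - N).PosSemidef ↔ ∀ x, x ⬝ᵥ (N *ᵥ x) ≤ x ⬝ᵥ (M *ᵥ x) := by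
  simp only [posSemidef_iff_dotProduct_mulVec, hM.sub hN, true_and, star_trivial, sub_mulVec,
    dotProduct_sub, sub_nonneg]

variable [DecidableEq n]

lemma posSemidef_smul_one_sub_mul_transpose_iff [DecidableEq m] {A : Matrix m n ℝ} {s : ℝ}
    (hs : 0 ≤ s) :
    (s ^ 2 • 1 - A * Aᵀ).PosSemidef ↔ l2OpNorm A ≤ s := by
  have hAA : (A * Aᵀ).IsHermitian := isHermitian_mul_conjTranspose_self A
  rw [posSemidef_sub_iff_dotProduct_mulVec_le (isHermitian_one.smul (IsSelfAdjoint.all _)) hAA,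
    ← l2OpNorm_transpose]
  simp only [dotProduct_mul_transpose_mulVec, smul_mulVec, one_mulVec, dotProduct_smul,
    smul_eq_mul]
  refine ⟨l2OpNorm_le_of_mulVec_dotProduct_self_le hs, fun h x => ?_⟩
  refine (mulVec_dotProduct_self_le Aᵀ x).trans ?_
  gcongr
  · exact dotProduct_self_eq_norm_sq x ▸ sq_nonneg _
  · exact l2OpNorm_nonneg _

lemma isUnit_det_of_le_mul_transpose {V : Matrix n n ℝ} {t : ℝ} (ht : 0 < t)
    (h : ∀ x, t * (x ⬝ᵥ x) ≤ x ⬝ᵥ ((V * Vᵀ) *ᵥ x)) : IsUnit V.det := by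
  rw [← det_transpose, ← isUnit_iff_isUnit_det, ← mulVec_injective_iff_isUnit]
  refine (injective_iff_map_eq_zero Vᵀ.mulVecLin).2 fun x hx => ?_
  have hle := h x
  rw [dotProduct_mul_transpose_mulVec, ← mulVecLin_apply, hx, dotProduct_zero] at hle
  exact dotProduct_self_eq_zero.1 <|
    le_antisymm (nonpos_of_mul_nonpos_right hle ht) (dotProduct_self_eq_norm_sq x ▸ sq_nonneg _)

lemma l2OpNorm_inv_le_of_le_mul_transpose {V : Matrix n n ℝ} {t : ℝ} (ht : 0 < t)
    (h : ∀ x, t * (x ⬝ᵥ x) ≤ x ⬝ᵥ ((V * Vᵀ) *ᵥ x)) : l2OpNorm V⁻¹ ≤ √t⁻¹ := by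
  have hV := isUnit_det_of_le_mul_transpose ht h
  rw [← l2OpNorm_transpose]
  refine l2OpNorm_le_of_mulVec_dotProduct_self_le (Real.sqrt_nonneg _) fun y => ?_
  have hy := h (V⁻¹ᵀ *ᵥ y)
  rw [dotProduct_mul_transpose_mulVec, mulVec_mulVec, ← transpose_mul, nonsing_inv_mul _ hV,
    transpose_one, one_mulVec] at hy
  rwa [Real.sq_sqrt (inv_nonneg.2 ht.le), inv_mul_eq_div, le_div_iff₀' ht]

end QuadraticForms

section LowerTriangular

variable {n : Type*} [LinearOrder n]

/-- The strictly lower triangular part of a matrix. -/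
def strictLower (M : Matrix n n ℝ) : Matrix n n ℝ :=
  Matrix.of fun i j => if j < i then M i j else 0

lemma strictLower_sub_transpose {A B : Matrix n n ℝ} (hA : A.IsLowerTriangular)
    (hB : B.IsLowerTriangular) : strictLower (A - Bᵀ) = A - diagonal fun k => A k k := by
  ext i j
  rw [strictLower, of_apply, Matrix.sub_apply, Matrix.sub_apply, transpose_apply]
  split_ifs with h
  · rw [hB h, diagonal_apply_ne _ h.ne']
  · rcases (not_lt.1 h).eq_or_lt with rfl | h
    · rw [diagonal_apply_eq, sub_self]
    · rw [hA h, diagonal_apply_ne _ h.ne, sub_zero]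

variable [Fintype n]

lemma mul_apply_self_of_isLowerTriangular {A B : Matrix n n ℝ} (hA : A.IsLowerTriangular)
    (hB : B.IsLowerTriangular) (k : n) : (A * B) k k = A k k * B k k := by
  rw [Matrix.mul_apply]
  refine Finset.sum_eq_single k (fun j _ hj => ?_) (by simp)
  rcases lt_or_gt_of_ne hj with h | h
  · rw [hB h, mul_zero]
  · rw [hA h, zero_mul]

lemma isLowerTriangular_inv {A : Matrix n n ℝ} (hA : A.IsLowerTriangular) (hu : IsUnit A.det) :
    A⁻¹.IsLowerTriangular :=
  have := A.invertibleOfIsUnitDet hu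
  blockTriangular_inv_of_blockTriangular hA

lemma apply_self_ne_zero_of_isLowerTriangular {A : Matrix n n ℝ} (hA : A.IsLowerTriangular)
    (hu : IsUnit A.det) (k : n) : A k k ≠ 0 := by
  rw [det_of_isLowerTriangular A hA] at hu
  exact Finset.prod_ne_zero_iff.1 hu.ne_zero k (Finset.mem_univ k)

lemma inv_apply_self_of_isLowerTriangular {A : Matrix n n ℝ} (hA : A.IsLowerTriangular)
    (hu : IsUnit A.det) (k : n) : A⁻¹ k k = (A k k)⁻¹ := by
  refine eq_inv_of_mul_eq_one_left ?_
  rw [← mul_apply_self_of_isLowerTriangular (isLowerTriangular_inv hA hu) hA,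
    nonsing_inv_mul _ hu, one_apply_eq]

lemma norm_strictLower_le (M : Matrix n n ℝ) : ‖strictLower M‖ ≤ ‖M‖ := by
  rw [← one_mul ‖M‖]
  refine frobenius_le_of_abs_le zero_le_one fun i j => ?_
  rw [strictLower, of_apply, one_mul]
  split_ifs <;> simp

/-- The matrix obtained by dividing each column of `V` by its diagonal entry: if `V` is the Cholesky
factor of `V Vᵀ`, this is the factor `L` of the LDL decomposition of `V Vᵀ`. -/
noncomputable def unitColumns (V : Matrix n n ℝ) : Matrix n n ℝ :=
  V * diagonal fun k => (V k k)⁻¹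

/-- Multiplying the difference of the Gram matrices by `U⁻¹` and `V⁻ᵀ` leaves `U⁻¹ V - (V⁻¹ U)ᵀ`,
whose strictly lower triangular part comes from `U⁻¹ V` alone. -/
lemma unitColumns_sub_unitColumns {U V : Matrix n n ℝ} (hU : U.IsLowerTriangular)
    (hV : V.IsLowerTriangular) (hUu : IsUnit U.det) (hVu : IsUnit V.det) :
    unitColumns V - unitColumns U
      = U * strictLower (U⁻¹ * (V * Vᵀ - U * Uᵀ) * V⁻¹ᵀ) * diagonal fun k => (V k k)⁻¹ := by
  have hUi := isLowerTriangular_inv hU hUu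
  have hVi := isLowerTriangular_inv hV hVu
  have hgram : U⁻¹ * (V * Vᵀ - U * Uᵀ) * V⁻¹ᵀ = U⁻¹ * V - (V⁻¹ * U)ᵀ := by
    have hVV : Vᵀ * V⁻¹ᵀ = 1 := by rw [← transpose_mul, nonsing_inv_mul _ hVu, transpose_one]
    rw [Matrix.mul_sub, Matrix.sub_mul, transpose_mul, ← Matrix.mul_assoc U⁻¹ U,
      nonsing_inv_mul _ hUu, Matrix.one_mul, ← Matrix.mul_assoc, Matrix.mul_assoc _ Vᵀ, hVV,
      Matrix.mul_one]
  have hdiag : diagonal (fun k => (U⁻¹ * V) k k) * diagonal (fun k => (V k k)⁻¹)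
      = diagonal fun k => (U k k)⁻¹ := by
    rw [diagonal_mul_diagonal]
    refine congrArg diagonal (funext fun k => ?_)
    rw [mul_apply_self_of_isLowerTriangular hUi hV, inv_apply_self_of_isLowerTriangular hU hUu,
      mul_inv_cancel_right₀ (apply_self_ne_zero_of_isLowerTriangular hV hVu k)]
  rw [hgram, strictLower_sub_transpose (hUi.mul hV) (hVi.mul hU), Matrix.mul_sub, Matrix.sub_mul,
    ← Matrix.mul_assoc U, mul_nonsing_inv _ hUu, Matrix.one_mul, Matrix.mul_assoc U (diagonal _),
    hdiag, unitColumns, unitColumns]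

lemma norm_mul_diagonal_inv_le {V : Matrix n n ℝ} (hV : V.IsLowerTriangular) (hVu : IsUnit V.det)
    (M : Matrix n n ℝ) : ‖M * diagonal fun k => (V k k)⁻¹‖ ≤ l2OpNorm V⁻¹ * ‖M‖ := by
  refine frobenius_le_of_abs_le (l2OpNorm_nonneg _) fun i k => ?_
  rw [mul_diagonal, abs_mul, mul_comm, ← inv_apply_self_of_isLowerTriangular hV hVu]
  gcongr
  exact abs_apply_le_l2OpNorm _ k k

lemma norm_unitColumns_sub_unitColumns_le {U V : Matrix n n ℝ} (hU : U.IsLowerTriangular)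
    (hV : V.IsLowerTriangular) (hUu : IsUnit U.det) (hVu : IsUnit V.det) :
    ‖unitColumns V - unitColumns U‖
      ≤ l2OpNorm V⁻¹ ^ 2 * l2OpNorm U * l2OpNorm U⁻¹ * ‖V * Vᵀ - U * Uᵀ‖ := by
  have hU0 := l2OpNorm_nonneg U
  have hV0 := l2OpNorm_nonneg V⁻¹
  set E := V * Vᵀ - U * Uᵀ
  have hE' : ‖U⁻¹ * E * V⁻¹ᵀ‖ ≤ l2OpNorm U⁻¹ * ‖E‖ * l2OpNorm V⁻¹ := by
    refine (norm_mul_le_mul_l2OpNorm _ _).trans ?_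
    rw [l2OpNorm_transpose]
    gcongr
    exact norm_mul_le_l2OpNorm_mul _ _
  calc ‖unitColumns V - unitColumns U‖
      ≤ l2OpNorm V⁻¹ * ‖U * strictLower (U⁻¹ * E * V⁻¹ᵀ)‖ := by
        rw [unitColumns_sub_unitColumns hU hV hUu hVu]
        exact norm_mul_diagonal_inv_le hV hVu _
    _ ≤ l2OpNorm V⁻¹ * (l2OpNorm U * ‖U⁻¹ * E * V⁻¹ᵀ‖) := by
        gcongr
        refine (norm_mul_le_l2OpNorm_mul _ _).trans ?_
        gcongr
        exact norm_strictLower_le _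
    _ ≤ l2OpNorm V⁻¹ * (l2OpNorm U * (l2OpNorm U⁻¹ * ‖E‖ * l2OpNorm V⁻¹)) := by gcongr
    _ = _ := by ring

end LowerTriangular

section Perturbation

variable {n : Type*} [Fintype n] [LinearOrder n]

lemma half_le_of_norm_sub_le {K M : Matrix n n ℝ} (hK : (K - 1).PosSemidef)
    (hM : ‖M - K‖ ≤ 1 / 2) (x : n → ℝ) : 1 / 2 * (x ⬝ᵥ x) ≤ x ⬝ᵥ (M *ᵥ x) := by
  have hKx := hK.dotProduct_mulVec_nonneg x
  have hMx := (abs_le.1 (abs_dotProduct_mulVec_le (M - K) x)).1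
  rw [sub_mulVec, one_mulVec, dotProduct_sub, star_trivial] at hKx
  rw [sub_mulVec, dotProduct_sub] at hMx
  have hx : 0 ≤ x ⬝ᵥ x := dotProduct_self_eq_norm_sq x ▸ sq_nonneg _
  nlinarith

lemma norm_unitColumns_sub_unitColumns_le_of_spectrum {U V : Matrix n n ℝ} {s : ℝ} (hs : 0 ≤ s)
    (hU : U.IsLowerTriangular) (hV : V.IsLowerTriangular) (hK : (U * Uᵀ - 1).PosSemidef)
    (hKs : (s • 1 - U * Uᵀ).PosSemidef) (hE : ‖V * Vᵀ - U * Uᵀ‖ ≤ 1 / 2) :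
    ‖unitColumns V - unitColumns U‖ ≤ 2 * √s * ‖V * Vᵀ - U * Uᵀ‖ := by
  have hVge := half_le_of_norm_sub_le hK hE
  have hUge (x : n → ℝ) : 1 * (x ⬝ᵥ x) ≤ x ⬝ᵥ ((U * Uᵀ) *ᵥ x) := by
    have hx := hK.dotProduct_mulVec_nonneg x
    rw [sub_mulVec, one_mulVec, dotProduct_sub, star_trivial] at hx
    linarith
  have hVi : l2OpNorm V⁻¹ ≤ √2 := by
    simpa using l2OpNorm_inv_le_of_le_mul_transpose one_half_pos hVge
  have hUi : l2OpNorm U⁻¹ ≤ 1 := by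
    simpa using l2OpNorm_inv_le_of_le_mul_transpose one_pos hUge
  have hUs : l2OpNorm U ≤ √s := by
    rwa [← posSemidef_smul_one_sub_mul_transpose_iff (Real.sqrt_nonneg s), Real.sq_sqrt hs]
  calc ‖unitColumns V - unitColumns U‖
      ≤ l2OpNorm V⁻¹ ^ 2 * l2OpNorm U * l2OpNorm U⁻¹ * ‖V * Vᵀ - U * Uᵀ‖ :=
        norm_unitColumns_sub_unitColumns_le hU hV (isUnit_det_of_le_mul_transpose one_pos hUge)
          (isUnit_det_of_le_mul_transpose one_half_pos hVge)
    _ ≤ √2 ^ 2 * √s * 1 * ‖V * Vᵀ - U * Uᵀ‖ := by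
        gcongr <;> exact l2OpNorm_nonneg _
    _ = 2 * √s * ‖V * Vᵀ - U * Uᵀ‖ := by rw [Real.sq_sqrt zero_le_two, mul_one]

end Perturbation

section LDL

variable {d : ℕ} {K L V : Matrix (Fin (d + 1)) (Fin (d + 1)) ℝ} {δ : Fin (d + 1) → ℝ}

lemma IsLDL.exists_unitColumns_eq (hL : IsLDL K L δ) (hK : K.PosDef) :
    ∃ U : Matrix (Fin (d + 1)) (Fin (d + 1)) ℝ,
      U.IsLowerTriangular ∧ U * Uᵀ = K ∧ unitColumns U = L := by
  obtain ⟨hdiag, hlow, rfl⟩ := hL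
  have hLlow : L.IsLowerTriangular := fun i j h => hlow i j h
  have hLu : IsUnit L := by
    simp [isUnit_iff_isUnit_det, det_of_isLowerTriangular L hLlow, hdiag]
  have hδ (k) : 0 < δ k :=
    posDef_diagonal_iff.1 ((Matrix.IsUnit.posDef_star_right_conjugate_iff hLu).1 hK) k
  have hsqrt : (diagonal fun k => √(δ k)) * (diagonal fun k => √(δ k)) = diagonal δ := by
    simp only [diagonal_mul_diagonal, Real.mul_self_sqrt (hδ _).le]
  refine ⟨L * diagonal fun k => √(δ k), hLlow.mul (blockTriangular_diagonal _), ?_, ?_⟩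
  · rw [transpose_mul, diagonal_transpose, Matrix.mul_assoc, ← Matrix.mul_assoc (diagonal _), hsqrt,
      Matrix.mul_assoc]
  · have hne (k) : √(δ k) ≠ 0 := (Real.sqrt_pos.2 (hδ k)).ne'
    simp only [unitColumns, mul_diagonal, hdiag, one_mul, Matrix.mul_assoc, diagonal_mul_diagonal,
      mul_inv_cancel₀ (hne _), diagonal_one, Matrix.mul_one]

lemma IsLDL.norm_unitColumns_sub_le (hL : IsLDL K L δ) {s : ℝ} (hs : 0 ≤ s)
    (hK : (K - 1).PosSemidef) (hKs : (s • 1 - K).PosSemidef) (hV : V.IsLowerTriangular)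
    (hE : ‖V * Vᵀ - K‖ ≤ 1 / 2) : ‖unitColumns V - L‖ ≤ 2 * √s * ‖V * Vᵀ - K‖ := by
  have hKpos : K.PosDef := by simpa using PosDef.one.add_posSemidef hK
  obtain ⟨U, hU, rfl, rfl⟩ := hL.exists_unitColumns_eq hKpos
  exact norm_unitColumns_sub_unitColumns_le_of_spectrum hs hU hV hK hKs hE

end LDL

section Displacement

lemma norm_le_of_pow_eq_zero {n : Type*} [Fintype n] [DecidableEq n] {N : Matrix n n ℝ} {k : ℕ}
    (hN : l2OpNorm N ≤ 1) (hNk : N ^ k = 0) (X : Matrix n n ℝ) :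
    ‖X‖ ≤ k * ‖X - N * X * Nᵀ‖ := by
  have hconj (M : Matrix n n ℝ) : ‖N * M * Nᵀ‖ ≤ ‖M‖ :=
    calc ‖N * M * Nᵀ‖ ≤ l2OpNorm N * ‖M‖ * l2OpNorm Nᵀ := by
          refine (norm_mul_le_mul_l2OpNorm _ _).trans ?_
          gcongr
          · exact l2OpNorm_nonneg _
          · exact norm_mul_le_l2OpNorm_mul _ _
      _ ≤ 1 * ‖M‖ * 1 := by
          rw [l2OpNorm_transpose]
          gcongr
          exact l2OpNorm_nonneg _
      _ = ‖M‖ := by ring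
  have htelescope (j : ℕ) : ‖X - N ^ j * X * Nᵀ ^ j‖ ≤ j * ‖X - N * X * Nᵀ‖ := by
    induction j with
    | zero => simp
    | succ j ih =>
      have hsplit : X - N ^ (j + 1) * X * Nᵀ ^ (j + 1)
          = (X - N * X * Nᵀ) + N * (X - N ^ j * X * Nᵀ ^ j) * Nᵀ := by
        rw [pow_succ', pow_succ]
        noncomm_ring
      calc ‖X - N ^ (j + 1) * X * Nᵀ ^ (j + 1)‖
          ≤ ‖X - N * X * Nᵀ‖ + ‖N * (X - N ^ j * X * Nᵀ ^ j) * Nᵀ‖ := hsplit ▸ norm_add_le _ _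
        _ ≤ ‖X - N * X * Nᵀ‖ + j * ‖X - N * X * Nᵀ‖ := by gcongr; exact (hconj _).trans ih
        _ = (j + 1 : ℕ) * ‖X - N * X * Nᵀ‖ := by push_cast; ring
  simpa [hNk] using htelescope k

variable {d : ℕ}

lemma lowerShift_mulVec (x : Fin (d + 1) → ℝ) (i : Fin (d + 1)) :
    (lowerShift d *ᵥ x) i = Fin.cases 0 (fun j => x j.castSucc) i := by
  induction i using Fin.cases with
  | zero => simp [lowerShift, mulVec, dotProduct]
  | succ i =>
    simp only [lowerShift, mulVec, dotProduct, of_apply, Fin.val_succ, Fin.cases_succ]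
    rw [Finset.sum_eq_single i.castSucc]
    · simp
    · intro j _ hj
      have : (i : ℕ) ≠ j := fun h => hj (Fin.ext (by simp [h]))
      simp [this]
    · simp

lemma l2OpNorm_lowerShift_le : l2OpNorm (lowerShift d) ≤ 1 := by
  refine l2OpNorm_le_of_mulVec_dotProduct_self_le zero_le_one fun x => ?_
  simp only [dotProduct, lowerShift_mulVec]
  rw [Fin.sum_univ_succ, Fin.sum_univ_castSucc (f := fun i => x i * x i)]
  simp only [Fin.cases_zero, Fin.cases_succ]
  nlinarith [mul_self_nonneg (x (Fin.last d))]

lemma lowerShift_pow_mulVec_eq_zero (k : ℕ) (x : Fin (d + 1) → ℝ) (i : Fin (d + 1))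
    (hi : (i : ℕ) < k) : (lowerShift d ^ k *ᵥ x) i = 0 := by
  induction k generalizing i with
  | zero => omega
  | succ k ih =>
    rw [pow_succ', ← mulVec_mulVec, lowerShift_mulVec]
    induction i using Fin.cases with
    | zero => rfl
    | succ j => exact ih _ (by simpa using hi)

lemma lowerShift_pow_eq_zero : lowerShift d ^ (d + 1) = 0 := by
  refine Matrix.ext_of_mulVec_single fun j => ?_
  ext i
  rw [lowerShift_pow_mulVec_eq_zero _ _ _ i.isLt, zero_mulVec, Pi.zero_apply]

lemma norm_le_of_displacement (X : Matrix (Fin (d + 1)) (Fin (d + 1)) ℝ) :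
    ‖X‖ ≤ (d + 1) * ‖X - lowerShift d * X * (lowerShift d)ᵀ‖ := by
  exact_mod_cast norm_le_of_pow_eq_zero l2OpNorm_lowerShift_le lowerShift_pow_eq_zero X

end Displacement

lemma one_add_pow_le {x : ℝ} {n : ℕ} (hx : 0 ≤ x) (hn : n * x ≤ 1 / 2) :
    (1 + x) ^ n ≤ 1 + 2 * (n * x) := by
  have hn0 : 0 ≤ n * x := by positivity
  calc (1 + x) ^ n ≤ Real.exp x ^ n := by
        gcongr
        rw [add_comm]
        exact Real.add_one_le_exp x
    _ = Real.exp (n * x) := (Real.exp_nat_mul x n).symm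
    _ ≤ 1 / (1 - n * x) := Real.exp_bound_div_one_sub_of_interval hn0 (by linarith)
    _ ≤ 1 + 2 * (n * x) := by
        rw [div_le_iff₀ (by linarith)]
        nlinarith

section RoundingErrors

/-- `x'` is a computed value of `x` after `k` roundings: `X` bounds the size of `x`, and the error
is at most what `k` relative errors `ε` can make of `X`. Sizes are carried along separately because
cancellation makes errors relative to `x` itself meaningless. -/
def Near (ε : ℝ) (k : ℕ) (X x' x : ℝ) : Prop := |x' - x| ≤ ((1 + ε) ^ k - 1) * X ∧ |x| ≤ X

variable {ε : ℝ} {k l : ℕ} {x x' y y' X Y : ℝ}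

lemma FloatArith.nonneg (A : FloatArith ε) : 0 ≤ ε := by
  obtain ⟨δ, hδ, -⟩ := A.add_err 0 0
  exact (abs_nonneg δ).trans hδ

lemma Near.refl (ε x : ℝ) : Near ε 0 |x| x x := by simp [Near]

lemma Near.size_nonneg (h : Near ε k X x' x) : 0 ≤ X := (abs_nonneg x).trans h.2

lemma Near.abs_le (h : Near ε k X x' x) : |x'| ≤ (1 + ε) ^ k * X := by
  have htri := abs_add_le (x' - x) x
  rw [sub_add_cancel] at htri
  linarith [h.1, h.2]

lemma Near.mono (hε : 0 ≤ ε) (h : Near ε k X x' x) (hkl : k ≤ l) (hXY : X ≤ Y) :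
    Near ε l Y x' x := by
  refine ⟨h.1.trans ?_, h.2.trans hXY⟩
  have hX := h.size_nonneg
  have hε' : 1 ≤ 1 + ε := by linarith
  have hl : 1 ≤ (1 + ε) ^ l := one_le_pow₀ hε'
  gcongr

lemma Near.neg (h : Near ε k X x' x) : Near ε k X (-x') (-x) := by
  refine ⟨?_, by rw [abs_neg]; exact h.2⟩
  rw [neg_sub_neg, abs_sub_comm]
  exact h.1

lemma Near.mul_one_add {δ : ℝ} (hδ : |δ| ≤ ε) (h : Near ε k X x' x) :
    Near ε (k + 1) X (x' * (1 + δ)) x := by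
  refine ⟨?_, h.2⟩
  calc |x' * (1 + δ) - x| = |(x' - x) + x' * δ| := by ring_nf
    _ ≤ |x' - x| + |x'| * |δ| := (abs_add_le _ _).trans_eq (by rw [abs_mul])
    _ ≤ ((1 + ε) ^ k - 1) * X + (1 + ε) ^ k * X * ε :=
        add_le_add h.1 (mul_le_mul h.abs_le hδ (abs_nonneg _) ((abs_nonneg _).trans h.abs_le))
    _ = ((1 + ε) ^ (k + 1) - 1) * X := by ring

lemma Near.mul (hx : Near ε k X x' x) (hy : Near ε l Y y' y) :
    Near ε (k + l) (X * Y) (x' * y') (x * y) := by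
  have hX := hx.size_nonneg
  refine ⟨?_, by rw [abs_mul]; exact mul_le_mul hx.2 hy.2 (abs_nonneg _) hX⟩
  calc |x' * y' - x * y| = |(x' - x) * y' + x * (y' - y)| := by ring_nf
    _ ≤ |x' - x| * |y'| + |x| * |y' - y| :=
        (abs_add_le _ _).trans_eq (by rw [abs_mul, abs_mul])
    _ ≤ ((1 + ε) ^ k - 1) * X * ((1 + ε) ^ l * Y) + X * (((1 + ε) ^ l - 1) * Y) :=
        add_le_add (mul_le_mul hx.1 hy.abs_le (abs_nonneg _) ((abs_nonneg _).trans hx.1))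
          (mul_le_mul hx.2 hy.1 (abs_nonneg _) hX)
    _ = ((1 + ε) ^ (k + l) - 1) * (X * Y) := by ring

lemma Near.add (hx : Near ε k X x' x) (hy : Near ε k Y y' y) :
    Near ε k (X + Y) (x' + y') (x + y) := by
  refine ⟨?_, (abs_add_le _ _).trans (add_le_add hx.2 hy.2)⟩
  rw [add_sub_add_comm, mul_add]
  exact (abs_add_le _ _).trans (add_le_add hx.1 hy.1)

lemma Near.sub (hx : Near ε k X x' x) (hy : Near ε k Y y' y) :
    Near ε k (X + Y) (x' - y') (x - y) := by
  simpa only [sub_eq_add_neg] using hx.add hy.neg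

lemma Near.ne_zero (hk : (1 + ε) ^ k ≤ 3 / 2) (hx0 : x ≠ 0) (h : Near ε k |x| x' x) : x' ≠ 0 := by
  rintro rfl
  have herr := h.1
  rw [zero_sub, abs_neg] at herr
  nlinarith [abs_pos.2 hx0]

lemma Near.inv (hε : 0 ≤ ε) (hk : (1 + ε) ^ k ≤ 3 / 2) (hx0 : x ≠ 0) (h : Near ε k |x| x' x) :
    Near ε (k + k) |x|⁻¹ x'⁻¹ x⁻¹ := by
  have hx : 0 < |x| := abs_pos.2 hx0
  have hx0' := h.ne_zero hk hx0
  have hx' : 0 < |x'| := abs_pos.2 hx0'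
  refine ⟨?_, (abs_inv x).le⟩
  have hp : 1 ≤ (1 + ε) ^ k := one_le_pow₀ (by linarith)
  set p := (1 + ε) ^ k with hpdef
  have hlow : (2 - p) * |x| ≤ |x'| := by
    have htri := abs_sub_abs_le_abs_sub x x'
    rw [abs_sub_comm x x'] at htri
    linarith [h.1]
  have hquad : 1 ≤ (p + 1) * (2 - p) := by nlinarith
  rw [inv_sub_inv hx0' hx0, abs_div, abs_mul, div_le_iff₀ (by positivity), abs_sub_comm, pow_add,
    ← hpdef]
  calc |x' - x| ≤ (p - 1) * |x| := h.1
    _ = (p - 1) * 1 * |x| := by ring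
    _ ≤ (p - 1) * ((p + 1) * (2 - p)) * |x| := by gcongr
    _ = (p * p - 1) * ((2 - p) * |x|) := by ring
    _ ≤ (p * p - 1) * |x'| := by gcongr; nlinarith
    _ = (p * p - 1) * |x|⁻¹ * (|x'| * |x|) := by field_simp

lemma Near.sqrt (hx : 0 ≤ x) (hx' : 0 ≤ x') (h : Near ε k x x' x) : Near ε k √x √x' √x := by
  refine ⟨?_, (abs_of_nonneg (Real.sqrt_nonneg x)).le⟩
  rcases hx.eq_or_lt with rfl | hpos
  · have : x' = 0 := by simpa using h.1
    simp [this]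
  have hsqrt := Real.sqrt_pos.2 hpos
  refine le_of_mul_le_mul_right ?_ hsqrt
  calc |√x' - √x| * √x ≤ |√x' - √x| * (√x' + √x) := by
        gcongr
        linarith [Real.sqrt_nonneg x']
    _ = |(√x' - √x) * (√x' + √x)| := by
        rw [abs_mul, abs_of_nonneg (by positivity : 0 ≤ √x' + √x)]
    _ = |x' - x| := by
        congr 1
        linear_combination Real.mul_self_sqrt hx' - Real.mul_self_sqrt hx
    _ ≤ ((1 + ε) ^ k - 1) * x := h.1
    _ = ((1 + ε) ^ k - 1) * √x * √x := by rw [mul_assoc, Real.mul_self_sqrt hx]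

variable (A : FloatArith ε)

lemma Near.fl_mul (hx : Near ε k X x' x) (hy : Near ε l Y y' y) :
    Near ε (k + l + 1) (X * Y) (A.mul x' y') (x * y) := by
  obtain ⟨δ, hδ, h⟩ := A.mul_err x' y'
  exact h ▸ (hx.mul hy).mul_one_add hδ

lemma Near.fl_add (hx : Near ε k X x' x) (hy : Near ε k Y y' y) :
    Near ε (k + 1) (X + Y) (A.add x' y') (x + y) := by
  obtain ⟨δ, hδ, h⟩ := A.add_err x' y'
  exact h ▸ (hx.add hy).mul_one_add hδ

lemma Near.fl_sub (hx : Near ε k X x' x) (hy : Near ε k Y y' y) :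
    Near ε (k + 1) (X + Y) (A.sub x' y') (x - y) := by
  obtain ⟨δ, hδ, h⟩ := A.sub_err x' y'
  exact h ▸ (hx.sub hy).mul_one_add hδ

lemma Near.fl_div (hk : (1 + ε) ^ k ≤ 3 / 2) (hy0 : y ≠ 0) (x : ℝ) (hy : Near ε k |y| y' y) :
    Near ε (k + k + 1) |x / y| (A.div x y') (x / y) := by
  obtain ⟨δ, hδ, h⟩ := A.div_err x y' (hy.ne_zero hk hy0)
  have hxy := (Near.refl ε x).mul (hy.inv A.nonneg hk hy0)
  rw [← div_eq_mul_inv, ← div_eq_mul_inv, ← div_eq_mul_inv, ← abs_div, zero_add] at hxy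
  exact h ▸ hxy.mul_one_add hδ

lemma Near.fl_sqrt (hx : 0 ≤ x) (hx' : 0 ≤ x') (h : Near ε k x x' x) :
    Near ε (k + 1) √x (A.sqrt x') √x := by
  obtain ⟨δ, hδ, hfl⟩ := A.sqrt_err x' hx'
  exact hfl ▸ (h.sqrt hx hx').mul_one_add hδ

end RoundingErrors

section PlaneQR

/-- Real arithmetic as a floating point arithmetic without rounding errors: running the algorithm
with it gives the exact quantities that the computed ones approximate. -/
@[simps]
noncomputable def exactArith : FloatArith 0 where
  add x y := x + y
  sub x y := x - y
  mul x y := x * y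
  div x y := x / y
  sqrt := Real.sqrt
  add_err x y := ⟨0, by simp⟩
  sub_err x y := ⟨0, by simp⟩
  mul_err x y := ⟨0, by simp⟩
  div_err x y _ := ⟨0, by simp⟩
  sqrt_err x _ := ⟨0, by simp⟩

lemma abs_mul_add_abs_mul_le (u v x y : ℝ) :
    |u| * |x| + |v| * |y| ≤ √(u ^ 2 + v ^ 2) * √(x ^ 2 + y ^ 2) := by
  simpa [Fin.sum_univ_two] using
    Real.sum_mul_le_sqrt_mul_sqrt Finset.univ ![|u|, |v|] ![|x|, |y|]

lemma abs_le_sqrt_sq_add_sq_left (x y : ℝ) : |x| ≤ √(x ^ 2 + y ^ 2) :=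
  Real.abs_le_sqrt (by nlinarith [sq_nonneg y])

lemma abs_le_sqrt_sq_add_sq_right (x y : ℝ) : |y| ≤ √(x ^ 2 + y ^ 2) :=
  Real.abs_le_sqrt (by nlinarith [sq_nonneg x])

lemma sq_add_sq_pos_of_not_and {a b : ℝ} (hab : ¬(a = 0 ∧ b = 0)) : 0 < a ^ 2 + b ^ 2 := by
  rcases not_and_or.1 hab with h | h <;> positivity

/-- The number `σ` in `householderQR`: the length of `(a, b)`, with the sign of `a`. -/
noncomputable def signedLength {ε : ℝ} (A : FloatArith ε) (a b : ℝ) : ℝ :=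
  if 0 ≤ a then flLength A a b else -flLength A a b

/-- The first entry `w` of the reflection vector `(w, b)` in `householderQR`. -/
noncomputable def reflectionHead {ε : ℝ} (A : FloatArith ε) (a b : ℝ) : ℝ :=
  A.add a (signedLength A a b)

/-- The multiple `t` of the reflection vector that `householderQR` subtracts from `(x, y)`. -/
noncomputable def reflectionCoeff {ε : ℝ} (A : FloatArith ε) (a b x y : ℝ) : ℝ :=
  A.mul (A.div 1 (A.mul (signedLength A a b) (reflectionHead A a b)))
    (A.add (A.mul (reflectionHead A a b) x) (A.mul b y))

lemma flLength_exactArith (a b : ℝ) : flLength exactArith a b = √(a ^ 2 + b ^ 2) := by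
  simp [flLength, sq]

lemma signedLength_exactArith_sq (a b : ℝ) : signedLength exactArith a b ^ 2 = a ^ 2 + b ^ 2 := by
  have hsq : √(a ^ 2 + b ^ 2) ^ 2 = a ^ 2 + b ^ 2 := Real.sq_sqrt (by positivity)
  rw [signedLength, flLength_exactArith]
  split_ifs
  · exact hsq
  · rwa [neg_sq]

lemma abs_signedLength_exactArith (a b : ℝ) :
    |signedLength exactArith a b| = √(a ^ 2 + b ^ 2) := by
  rw [← signedLength_exactArith_sq, Real.sqrt_sq_eq_abs]

lemma abs_reflectionHead_exactArith (a b : ℝ) :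
    |reflectionHead exactArith a b| = |a| + |signedLength exactArith a b| := by
  have hlength : 0 ≤ flLength exactArith a b := Real.sqrt_nonneg _
  refine abs_add_eq_add_abs_iff _ _ |>.2 ?_
  unfold signedLength
  split_ifs with ha
  · exact .inl ⟨ha, hlength⟩
  · exact .inr ⟨(not_le.1 ha).le, neg_nonpos.2 hlength⟩

lemma reflectionHead_exactArith_sq_add (a b : ℝ) :
    reflectionHead exactArith a b ^ 2 + b ^ 2 =
      2 * (signedLength exactArith a b * reflectionHead exactArith a b) := by
  rw [reflectionHead, exactArith_add]
  linear_combination -signedLength_exactArith_sq a b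

lemma signedLength_mul_reflectionHead_exactArith_pos {a b : ℝ} (hab : ¬(a = 0 ∧ b = 0)) :
    0 < signedLength exactArith a b * reflectionHead exactArith a b := by
  have hσ : 0 < |signedLength exactArith a b| := by
    rw [abs_signedLength_exactArith]
    exact Real.sqrt_pos.2 (sq_add_sq_pos_of_not_and hab)
  have hw : 0 < |reflectionHead exactArith a b| := by
    rw [abs_reflectionHead_exactArith]
    positivity
  have hww := reflectionHead_exactArith_sq_add a b
  nlinarith [pow_pos hw 2, sq_abs (reflectionHead exactArith a b), sq_nonneg b]

section RowErrors

variable {ε : ℝ} (A : FloatArith ε)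

lemma near_flLength (hε : ε ≤ 1) (a b : ℝ) :
    Near ε 3 √(a ^ 2 + b ^ 2) (flLength A a b) √(a ^ 2 + b ^ 2) := by
  have hsquare (z : ℝ) : Near ε 1 (z ^ 2) (A.mul z z) (z ^ 2) := by
    have h := (Near.refl ε z).fl_mul A (Near.refl ε z)
    rwa [abs_mul_abs_self, ← sq] at h
  have hround {δ : ℝ} (hδ : |δ| ≤ ε) : 0 ≤ 1 + δ := by linarith [(abs_le.1 hδ).1]
  have hmul (z : ℝ) : 0 ≤ A.mul z z := by
    obtain ⟨δ, hδ, h⟩ := A.mul_err z z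
    exact h ▸ mul_nonneg (mul_self_nonneg z) (hround hδ)
  have hadd : 0 ≤ A.add (A.mul a a) (A.mul b b) := by
    obtain ⟨δ, hδ, h⟩ := A.add_err (A.mul a a) (A.mul b b)
    exact h ▸ mul_nonneg (add_nonneg (hmul a) (hmul b)) (hround hδ)
  exact ((hsquare a).fl_add A (hsquare b)).fl_sqrt A (by positivity) hadd

lemma near_rotation_entries (hε : ε ≤ 1 / 10) {a b : ℝ} (hab : ¬(a = 0 ∧ b = 0)) (x y : ℝ) :
    Near ε 9 √(x ^ 2 + y ^ 2)
      (A.add (A.mul (A.div a (flLength A a b)) x) (A.mul (A.div b (flLength A a b)) y))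
      (a / √(a ^ 2 + b ^ 2) * x + b / √(a ^ 2 + b ^ 2) * y) ∧
    Near ε 9 √(x ^ 2 + y ^ 2)
      (A.sub (A.mul (A.div a (flLength A a b)) y) (A.mul (A.div b (flLength A a b)) x))
      (a / √(a ^ 2 + b ^ 2) * y - b / √(a ^ 2 + b ^ 2) * x) := by
  have hε0 := A.nonneg
  have hsq := sq_add_sq_pos_of_not_and hab
  have hlength := near_flLength A (by linarith) a b
  have hr := Real.sqrt_pos.2 hsq
  have hr2 := Real.sq_sqrt hsq.le
  set r := √(a ^ 2 + b ^ 2)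
  rw [← abs_of_pos hr, abs_of_pos hr] at hlength
  have hunit : (a / r) ^ 2 + (b / r) ^ 2 = 1 := by
    rw [div_pow, div_pow, ← add_div, hr2, div_self hsq.ne']
  have hprod (u z : ℝ) : Near ε 8 (|u / r| * |z|) (A.mul (A.div u (flLength A a b)) z)
      (u / r * z) := by
    have hpow : (1 + ε) ^ 3 ≤ 3 / 2 := by
      calc (1 + ε) ^ 3 ≤ (1 + 1 / 10) ^ 3 := by gcongr
        _ ≤ 3 / 2 := by norm_num
    exact (Near.fl_div A hpow hr.ne' u ((abs_of_pos hr).symm ▸ hlength)).fl_mul A (Near.refl ε z)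
  have hsize (p q : ℝ) : |a / r| * |p| + |b / r| * |q| ≤ √(p ^ 2 + q ^ 2) := by
    simpa [hunit] using abs_mul_add_abs_mul_le (a / r) (b / r) p q
  refine ⟨((hprod a x).fl_add A (hprod b y)).mono hε0 le_rfl (hsize x y), ?_⟩
  rw [add_comm (x ^ 2)]
  exact ((hprod a y).fl_sub A (hprod b x)).mono hε0 le_rfl (hsize y x)

lemma near_signedLength (hε : ε ≤ 1) (a b : ℝ) :
    Near ε 3 |signedLength exactArith a b| (signedLength A a b) (signedLength exactArith a b) := by
  rw [abs_signedLength_exactArith, signedLength, signedLength, flLength_exactArith]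
  split_ifs
  · exact near_flLength A hε a b
  · exact (near_flLength A hε a b).neg

lemma near_reflectionHead (hε : ε ≤ 1) (a b : ℝ) :
    Near ε 4 |reflectionHead exactArith a b| (reflectionHead A a b)
      (reflectionHead exactArith a b) := by
  rw [abs_reflectionHead_exactArith]
  exact ((Near.refl ε a).mono A.nonneg (Nat.zero_le 3) le_rfl).fl_add A (near_signedLength A hε a b)

lemma near_reflectionCoeff (hε : ε ≤ 1 / 100) {a b : ℝ} (hab : ¬(a = 0 ∧ b = 0)) (x y : ℝ) :
    Near ε 24
      (2 / √(reflectionHead exactArith a b ^ 2 + b ^ 2) * √(x ^ 2 + y ^ 2))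
      (reflectionCoeff A a b x y) (reflectionCoeff exactArith a b x y) := by
  have hε0 := A.nonneg
  have hσ := near_signedLength A (by linarith) a b
  have hw := near_reflectionHead A (by linarith) a b
  have hσw := signedLength_mul_reflectionHead_exactArith_pos hab
  have hww := reflectionHead_exactArith_sq_add a b
  have hcoeff : reflectionCoeff exactArith a b x y =
      1 / (signedLength exactArith a b * reflectionHead exactArith a b) *
        (reflectionHead exactArith a b * x + b * y) := rfl
  rw [hcoeff]
  unfold reflectionCoeff
  set σ := signedLength exactArith a b
  set w := reflectionHead exactArith a b
  set n := √(w ^ 2 + b ^ 2) with hn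
  have hn2 : n ^ 2 = 2 * (σ * w) := by rw [hn, Real.sq_sqrt (by positivity), hww]
  have hpow : (1 + ε) ^ 8 ≤ 3 / 2 := by
    calc (1 + ε) ^ 8 ≤ (1 + 1 / 100) ^ 8 := by gcongr
      _ ≤ 3 / 2 := by norm_num
  have hscale := Near.fl_div A hpow hσw.ne' 1 (abs_mul σ w ▸ hσ.fl_mul A hw)
  have hwx := hw.fl_mul A (Near.refl ε x)
  have hby := ((Near.refl ε b).fl_mul A (Near.refl ε y)).mono hε0
    (by norm_num : 0 + 0 + 1 ≤ 5) le_rfl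
  have hinner := (hwx.fl_add A hby).mono hε0 le_rfl (abs_mul_add_abs_mul_le w b x y)
  refine (hscale.fl_mul A hinner).mono hε0 (by norm_num) (le_of_eq ?_)
  have hn0 : n ≠ 0 := fun h => by rw [h] at hn2; linarith
  rw [abs_of_pos (one_div_pos.2 hσw), show σ * w = n ^ 2 / 2 by linarith]
  field_simp
  rfl

lemma near_reflection_entries (hε : ε ≤ 1 / 100) {a b : ℝ} (hab : ¬(a = 0 ∧ b = 0)) (x y : ℝ) :
    Near ε 30 (3 * √(x ^ 2 + y ^ 2))
      (A.sub x (A.mul (reflectionCoeff A a b x y) (reflectionHead A a b)))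
      (x - reflectionCoeff exactArith a b x y * reflectionHead exactArith a b) ∧
    Near ε 30 (3 * √(x ^ 2 + y ^ 2))
      (A.sub y (A.mul (reflectionCoeff A a b x y) b))
      (y - reflectionCoeff exactArith a b x y * b) := by
  have hε0 := A.nonneg
  have ht := near_reflectionCoeff A hε hab x y
  have hw := near_reflectionHead A (by linarith) a b
  have hσw := signedLength_mul_reflectionHead_exactArith_pos hab
  have hn : 0 < √(reflectionHead exactArith a b ^ 2 + b ^ 2) := by
    rw [reflectionHead_exactArith_sq_add]
    positivity
  have hwn := abs_le_sqrt_sq_add_sq_left (reflectionHead exactArith a b) b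
  have hbn := abs_le_sqrt_sq_add_sq_right (reflectionHead exactArith a b) b
  set w := reflectionHead exactArith a b
  set n := √(w ^ 2 + b ^ 2)
  set N := √(x ^ 2 + y ^ 2)
  have hsize {v : ℝ} (hv : |v| ≤ n) : 2 / n * N * |v| ≤ 2 * N := by
    calc 2 / n * N * |v| ≤ 2 / n * N * n := by gcongr
      _ = 2 * N := by field_simp
  have hentry {z s' s : ℝ} (hz : |z| ≤ N) (hs : Near ε 29 (2 * N) s' s) :
      Near ε 30 (3 * N) (A.sub z s') (z - s) :=
    (((Near.refl ε z).mono hε0 (Nat.zero_le 29) hz).fl_sub A hs).mono hε0 le_rfl (by linarith)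
  exact ⟨hentry (abs_le_sqrt_sq_add_sq_left x y)
      ((ht.fl_mul A hw).mono hε0 le_rfl (hsize hwn)),
    hentry (abs_le_sqrt_sq_add_sq_right x y)
      ((ht.fl_mul A (Near.refl ε b)).mono hε0 (by norm_num) (hsize hbn))⟩

end RowErrors

section FactorErrors

variable {d : ℕ} (k : Fin (d + 1)) (G : Matrix (Fin (d + 1)) (Fin 2) ℝ)

lemma exists_rotationQR_exactArith_eq_mul (hk : ¬(G k 0 = 0 ∧ G k 1 = 0)) :
    ∃ Q : Matrix (Fin 2) (Fin 2) ℝ, Q * Qᵀ = 1 ∧ rotationQR exactArith k G = G * Q := by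
  have hsq := sq_add_sq_pos_of_not_and hk
  have hlength := flLength_exactArith (G k 0) (G k 1)
  have hr := Real.sqrt_pos.2 hsq
  have hr2 := Real.sq_sqrt hsq.le
  set r := √(G k 0 ^ 2 + G k 1 ^ 2)
  refine ⟨!![G k 0 / r, -(G k 1 / r); G k 1 / r, G k 0 / r], ?_, ?_⟩
  · ext i j
    fin_cases i <;> fin_cases j <;> simp [Matrix.mul_apply] <;> field_simp <;> linarith
  · ext i j
    by_cases hik : i = k
    · subst hik
      fin_cases j <;> simp [rotationQR, hlength, Matrix.mul_apply] <;> field_simp <;> linarith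
    · fin_cases j <;> simp [rotationQR, hlength, hik, Matrix.mul_apply] <;> ring

lemma reflectionCoeff_exactArith_self {a b : ℝ} (hab : ¬(a = 0 ∧ b = 0)) :
    reflectionCoeff exactArith a b a b = 1 := by
  have hσw := signedLength_mul_reflectionHead_exactArith_pos hab
  have hsq := signedLength_exactArith_sq a b
  simp only [reflectionCoeff, exactArith_mul, exactArith_div, exactArith_add]
  rw [one_div_mul_eq_div, div_eq_one_iff_eq hσw.ne']
  simp only [reflectionHead, exactArith_add]
  linear_combination -hsq

lemma householderQR_apply_of_ne {ε : ℝ} (A : FloatArith ε) {i : Fin (d + 1)} (hik : i ≠ k) :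
    householderQR A k G i =
      ![A.sub (G i 0) (A.mul (reflectionCoeff A (G k 0) (G k 1) (G i 0) (G i 1))
          (reflectionHead A (G k 0) (G k 1))),
        A.sub (G i 1) (A.mul (reflectionCoeff A (G k 0) (G k 1) (G i 0) (G i 1)) (G k 1))] := by
  exact (if_neg hik).trans rfl

lemma householderQR_exactArith_apply (hk : ¬(G k 0 = 0 ∧ G k 1 = 0)) (i : Fin (d + 1)) :
    householderQR exactArith k G i =
      ![G i 0 - reflectionCoeff exactArith (G k 0) (G k 1) (G i 0) (G i 1) *
          reflectionHead exactArith (G k 0) (G k 1),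
        G i 1 - reflectionCoeff exactArith (G k 0) (G k 1) (G i 0) (G i 1) * G k 1] := by
  rcases eq_or_ne i k with rfl | hik
  · rw [reflectionCoeff_exactArith_self hk]
    refine (if_pos rfl).trans ?_
    simp [reflectionHead, signedLength]
  · exact householderQR_apply_of_ne k G exactArith hik

lemma exists_householderQR_exactArith_eq_mul (hk : ¬(G k 0 = 0 ∧ G k 1 = 0)) :
    ∃ Q : Matrix (Fin 2) (Fin 2) ℝ, Q * Qᵀ = 1 ∧ householderQR exactArith k G = G * Q := by
  have hσw := signedLength_mul_reflectionHead_exactArith_pos hk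
  have hww := reflectionHead_exactArith_sq_add (G k 0) (G k 1)
  have hrow := householderQR_exactArith_apply k G hk
  simp only [reflectionCoeff, exactArith_mul, exactArith_div, exactArith_add] at hrow
  set σ := signedLength exactArith (G k 0) (G k 1)
  set w := reflectionHead exactArith (G k 0) (G k 1)
  set b := G k 1
  set β := 1 / (σ * w) with hβ
  have hβww : β * (w ^ 2 + b ^ 2) = 2 := by
    rw [hww, mul_left_comm, hβ, one_div_mul_cancel hσw.ne', mul_one]
  refine ⟨!![1 - β * w ^ 2, -(β * w * b); -(β * w * b), 1 - β * b ^ 2], ?_, ?_⟩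
  · ext i j
    fin_cases i <;> fin_cases j <;> simp [Matrix.mul_apply]
    · linear_combination β * w ^ 2 * hβww
    · linear_combination β * w * b * hβww
    · linear_combination β * w * b * hβww
    · linear_combination β * b ^ 2 * hβww
  · ext i j
    fin_cases j <;> simp [hrow, Matrix.mul_apply] <;> ring

lemma exists_qrFactor_exactArith_eq_mul (m : QRMethod) :
    ∃ Q : Matrix (Fin 2) (Fin 2) ℝ, Q * Qᵀ = 1 ∧ qrFactor exactArith m k G = G * Q := by
  by_cases hk : G k 0 = 0 ∧ G k 1 = 0
  · exact ⟨1, by simp, by simp [qrFactor, hk]⟩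
  · simp only [qrFactor, if_neg hk]
    cases m
    · exact exists_rotationQR_exactArith_eq_mul k G hk
    · exact exists_householderQR_exactArith_eq_mul k G hk

variable {ε : ℝ} (A : FloatArith ε)

lemma near_rotationQR (hε : ε ≤ 1 / 10) (hk : ¬(G k 0 = 0 ∧ G k 1 = 0)) (i : Fin (d + 1))
    (j : Fin 2) :
    Near ε 9 √(G i 0 ^ 2 + G i 1 ^ 2) (rotationQR A k G i j) (rotationQR exactArith k G i j) := by
  have hε0 := A.nonneg
  rcases eq_or_ne i k with rfl | hik
  · fin_cases j
    · simpa [rotationQR, flLength_exactArith] using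
        (near_flLength A (by linarith) (G i 0) (G i 1)).mono hε0 (by norm_num) le_rfl
    · simpa [rotationQR] using (Near.refl ε 0).mono hε0 (Nat.zero_le 9) (by simp)
  · have h := near_rotation_entries A hε hk (G i 0) (G i 1)
    fin_cases j
    · simpa [rotationQR, hik, flLength_exactArith] using h.1
    · simpa [rotationQR, hik, flLength_exactArith] using h.2

lemma near_householderQR (hε : ε ≤ 1 / 100) (hk : ¬(G k 0 = 0 ∧ G k 1 = 0)) (i : Fin (d + 1))
    (j : Fin 2) :
    Near ε 30 (3 * √(G i 0 ^ 2 + G i 1 ^ 2)) (householderQR A k G i j)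
      (householderQR exactArith k G i j) := by
  have hε0 := A.nonneg
  have hsize : 0 ≤ √(G i 0 ^ 2 + G i 1 ^ 2) := Real.sqrt_nonneg _
  rcases eq_or_ne i k with rfl | hik
  · fin_cases j
    · have hσ := (near_signedLength A (by linarith) (G i 0) (G i 1)).neg
      rw [abs_signedLength_exactArith] at hσ
      simpa [householderQR, signedLength] using hσ.mono hε0 (by norm_num : 3 ≤ 30) (by linarith)
    · simpa [householderQR] using (Near.refl ε 0).mono hε0 (Nat.zero_le 30) (by simp)
  · have h := near_reflection_entries A hε hk (G i 0) (G i 1)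
    rw [householderQR_apply_of_ne k G A hik, householderQR_apply_of_ne k G exactArith hik]
    fin_cases j
    · exact h.1
    · exact h.2

lemma near_qrFactor (hε : ε ≤ 1 / 100) (m : QRMethod) (i : Fin (d + 1)) (j : Fin 2) :
    Near ε 30 (3 * √(G i 0 ^ 2 + G i 1 ^ 2)) (qrFactor A m k G i j)
      (qrFactor exactArith m k G i j) := by
  have hε0 := A.nonneg
  have hsize : 0 ≤ √(G i 0 ^ 2 + G i 1 ^ 2) := Real.sqrt_nonneg _
  by_cases hk : G k 0 = 0 ∧ G k 1 = 0
  · simp only [qrFactor, if_pos hk]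
    refine (Near.refl ε (G i j)).mono hε0 (Nat.zero_le 30) ?_
    have h0 := abs_le_sqrt_sq_add_sq_left (G i 0) (G i 1)
    have h1 := abs_le_sqrt_sq_add_sq_right (G i 0) (G i 1)
    fin_cases j
    · exact h0.trans (by linarith)
    · exact h1.trans (by linarith)
  · simp only [qrFactor, if_neg hk]
    cases m
    · exact (near_rotationQR k G A (by linarith) hk i j).mono hε0 (by norm_num) (by linarith)
    · exact near_householderQR k G A hε hk i j

lemma norm_qrFactor_sub_le (hε : ε ≤ 1 / 100) (m : QRMethod) :
    ‖qrFactor A m k G - qrFactor exactArith m k G‖ ≤ 360 * ε * ‖G‖ := by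
  have hε0 := A.nonneg
  have hpow : (1 + ε) ^ 30 ≤ 1 + 2 * (30 * ε) :=
    mod_cast one_add_pow_le (n := 30) hε0 (by push_cast; linarith)
  refine frobenius_le_of_row_le (by positivity) fun i => ?_
  have hentry (j : Fin 2) : (qrFactor A m k G - qrFactor exactArith m k G) i j ^ 2
      ≤ (180 * ε) ^ 2 * (G i 0 ^ 2 + G i 1 ^ 2) := by
    rw [← Real.sq_sqrt (by positivity : 0 ≤ G i 0 ^ 2 + G i 1 ^ 2), ← mul_pow, sq_le_sq]
    refine (near_qrFactor k G A hε m i j).1.trans (le_trans ?_ (le_abs_self _))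
    nlinarith [Real.sqrt_nonneg (G i 0 ^ 2 + G i 1 ^ 2)]
  have hsum := add_le_add (hentry 0) (hentry 1)
  rw [Fin.sum_univ_two, Fin.sum_univ_two]
  nlinarith [sq_nonneg (ε * G i 0), sq_nonneg (ε * G i 1)]

lemma qrFactor_exactArith_mul_transpose (m : QRMethod) :
    qrFactor exactArith m k G * (qrFactor exactArith m k G)ᵀ = G * Gᵀ := by
  obtain ⟨Q, hQ, h⟩ := exists_qrFactor_exactArith_eq_mul k G m
  rw [h, transpose_mul, Matrix.mul_assoc, ← Matrix.mul_assoc Q, hQ, Matrix.one_mul]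

lemma norm_qrFactor_exactArith (m : QRMethod) : ‖qrFactor exactArith m k G‖ = ‖G‖ :=
  frobenius_eq_of_mul_transpose_eq (qrFactor_exactArith_mul_transpose k G m)

lemma norm_qrFactor_le (hε : ε ≤ 1 / 100) (m : QRMethod) :
    ‖qrFactor A m k G‖ ≤ (1 + 360 * ε) * ‖G‖ := by
  calc ‖qrFactor A m k G‖
      = ‖(qrFactor A m k G - qrFactor exactArith m k G) + qrFactor exactArith m k G‖ := by
        rw [sub_add_cancel]
    _ ≤ 360 * ε * ‖G‖ + ‖G‖ :=
        (norm_add_le _ _).trans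
          (add_le_add (norm_qrFactor_sub_le k G A hε m) (norm_qrFactor_exactArith k G m).le)
    _ = (1 + 360 * ε) * ‖G‖ := by ring

lemma norm_qrFactor_mul_transpose_sub_le (hε : ε ≤ 1 / 10000) (m : QRMethod) :
    ‖qrFactor A m k G * (qrFactor A m k G)ᵀ - G * Gᵀ‖ ≤ 1000 * ε * ‖G‖ ^ 2 := by
  have hε0 := A.nonneg
  have hdiff := norm_qrFactor_sub_le k G A (by linarith) m
  have hproduct := norm_mul_transpose_sub_le (qrFactor A m k G) (qrFactor exactArith m k G)
  rw [qrFactor_exactArith_mul_transpose, norm_qrFactor_exactArith] at hproduct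
  calc ‖qrFactor A m k G * (qrFactor A m k G)ᵀ - G * Gᵀ‖
      ≤ 360 * ε * ‖G‖ * (360 * ε * ‖G‖ + 2 * ‖G‖) := hproduct.trans (by gcongr)
    _ = 360 * (360 * ε + 2) * ε * ‖G‖ ^ 2 := by ring
    _ ≤ 1000 * ε * ‖G‖ ^ 2 := by gcongr; linarith

end FactorErrors

end PlaneQR

section BackwardError

variable {ε : ℝ} (A : FloatArith ε) (m : QRMethod) {d : ℕ}

lemma FloatArith.mul_zero_eq_zero (x : ℝ) : A.mul x 0 = 0 := by
  obtain ⟨δ, -, h⟩ := A.mul_err x 0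
  simpa using h

lemma FloatArith.add_zero_zero : A.add 0 0 = 0 := by
  obtain ⟨δ, -, h⟩ := A.add_err 0 0
  simpa using h

lemma FloatArith.sub_zero_zero : A.sub 0 0 = 0 := by
  obtain ⟨δ, -, h⟩ := A.sub_err 0 0
  simpa using h

lemma FloatArith.zero_mul_eq_zero (x : ℝ) : A.mul 0 x = 0 := by
  obtain ⟨δ, -, h⟩ := A.mul_err 0 x
  simpa using h

lemma qrFactor_eq_zero_of_row_eq_zero {k i : Fin (d + 1)} {G : Matrix (Fin (d + 1)) (Fin 2) ℝ}
    (h : ∀ j, G i j = 0) (j : Fin 2) : qrFactor A m k G i j = 0 := by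
  by_cases hk : G k 0 = 0 ∧ G k 1 = 0
  · simp only [qrFactor, if_pos hk, h]
  · have hik : i ≠ k := by
      rintro rfl
      exact hk ⟨h 0, h 1⟩
    cases m <;> fin_cases j <;>
      simp [qrFactor, hk, rotationQR, householderQR, hik, h, A.mul_zero_eq_zero,
        A.zero_mul_eq_zero, A.add_zero_zero, A.sub_zero_zero]

lemma qrFactor_pivot_one (k : Fin (d + 1)) (G : Matrix (Fin (d + 1)) (Fin 2) ℝ) :
    qrFactor A m k G k 1 = 0 := by
  by_cases hk : G k 0 = 0 ∧ G k 1 = 0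
  · simp only [qrFactor, if_pos hk]
    exact hk.2
  · cases m <;> simp [qrFactor, hk, rotationQR, householderQR]

lemma nextGenerator_eq_zero_of_le {k : Fin (d + 1)} {G : Matrix (Fin (d + 1)) (Fin 2) ℝ}
    (h : ∀ i < k, ∀ j, G i j = 0) {i : Fin (d + 1)} (hi : i ≤ k) (j : Fin 2) :
    nextGenerator A m k G i j = 0 := by
  fin_cases j
  · simp only [nextGenerator, of_apply, Fin.zero_eta, cons_val_zero, lowerShift_mulVec]
    induction i using Fin.cases with
    | zero => rfl
    | succ i => exact qrFactor_eq_zero_of_row_eq_zero A m (h _ (i.castSucc_lt_succ.trans_le hi)) 0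
  · simp only [nextGenerator, of_apply, Fin.mk_one, cons_val_one, cons_val_fin_one]
    rcases hi.eq_or_lt with rfl | hi
    · exact qrFactor_pivot_one A m i G
    · exact qrFactor_eq_zero_of_row_eq_zero A m (h i hi) 1

variable (G : Matrix (Fin (d + 1)) (Fin 2) ℝ)

lemma generator_eq_zero_of_lt {n : ℕ} (hn : n ≤ d + 1) {i : Fin (d + 1)} (hi : (i : ℕ) < n)
    (j : Fin 2) : generator A m G n i j = 0 := by
  induction n generalizing i j with
  | zero => exact absurd hi (Nat.not_lt_zero _)
  | succ n ih =>
    have hval : (Fin.ofNat (d + 1) n : ℕ) = n := Nat.mod_eq_of_lt hn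
    refine nextGenerator_eq_zero_of_le A m (fun i hi j => ih (by omega) ?_ j) ?_ j
    · rwa [Fin.lt_def, hval] at hi
    · rw [Fin.le_def, hval]
      exact Nat.le_of_lt_succ hi

lemma generator_last : generator A m G (d + 1) = 0 := by
  ext i j
  exact generator_eq_zero_of_lt A m G le_rfl i.isLt j

lemma computedU_isLowerTriangular : (computedU A m G).IsLowerTriangular := fun _ k h =>
  qrFactor_eq_zero_of_row_eq_zero A m (generator_eq_zero_of_lt A m G k.isLt.le h) 0

/-- The computed factor `R̂_n = [û_n, v̂_n]` of step `n`. -/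
noncomputable def computedR (n : ℕ) : Matrix (Fin (d + 1)) (Fin 2) ℝ :=
  qrFactor A m (Fin.ofNat (d + 1) n) (generator A m G n)

lemma computedU_apply (i k : Fin (d + 1)) : computedU A m G i k = computedR A m G k i 0 := by
  rw [computedR, show Fin.ofNat (d + 1) (k : ℕ) = k from Fin.ext (Nat.mod_eq_of_lt k.isLt)]
  rfl

lemma computedU_mul_transpose :
    computedU A m G * (computedU A m G)ᵀ = ∑ n ∈ Finset.range (d + 1),
      vecMulVec (fun i => computedR A m G n i 0) (fun i => computedR A m G n i 0) := by
  rw [Finset.sum_range]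
  ext i j
  simp only [Matrix.mul_apply, transpose_apply, computedU_apply, Matrix.sum_apply, vecMulVec_apply]

lemma generator_succ_mul_transpose (n : ℕ) :
    generator A m G (n + 1) * (generator A m G (n + 1))ᵀ =
      computedR A m G n * (computedR A m G n)ᵀ
        - vecMulVec (fun i => computedR A m G n i 0) (fun i => computedR A m G n i 0)
        + lowerShift d * vecMulVec (fun i => computedR A m G n i 0)
          (fun i => computedR A m G n i 0) * (lowerShift d)ᵀ := by
  rw [mul_vecMulVec, vecMulVec_mul, vecMul_transpose]
  ext i j
  simp only [generator, nextGenerator, Matrix.mul_apply, Fin.sum_univ_two, transpose_apply,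
    of_apply, cons_val_zero, cons_val_one, cons_val_fin_one, Matrix.add_apply, Matrix.sub_apply,
    vecMulVec_apply, computedR]
  ring

lemma displacement_computedU_mul_transpose :
    computedU A m G * (computedU A m G)ᵀ
        - lowerShift d * (computedU A m G * (computedU A m G)ᵀ) * (lowerShift d)ᵀ =
      G * Gᵀ + ∑ n ∈ Finset.range (d + 1), (computedR A m G n * (computedR A m G n)ᵀ
        - generator A m G n * (generator A m G n)ᵀ) := by
  have htelescope :=
    Finset.sum_range_sub (fun n => generator A m G n * (generator A m G n)ᵀ) (d + 1)
  rw [generator_last, Matrix.zero_mul, zero_sub, show generator A m G 0 = G from rfl] at htelescope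
  rw [computedU_mul_transpose, Matrix.mul_sum, Matrix.sum_mul, ← sub_eq_iff_eq_add',
    sub_eq_add_neg, ← htelescope, ← Finset.sum_sub_distrib, ← Finset.sum_add_distrib]
  refine Finset.sum_congr rfl fun n _ => ?_
  rw [generator_succ_mul_transpose]
  abel

lemma precision_le (hε0 : 0 ≤ ε) (hε : (d + 1) * ε ≤ 1 / 10000) : ε ≤ 1 / 10000 :=
  (le_mul_of_one_le_left hε0 (by simp)).trans hε

lemma norm_nextGenerator_le (k : Fin (d + 1)) :
    ‖nextGenerator A m k G‖ ≤ ‖qrFactor A m k G‖ := by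
  have hshift := mulVec_dotProduct_self_le (lowerShift d) fun i => qrFactor A m k G i 0
  have hcontract : l2OpNorm (lowerShift d) ^ 2 ≤ 1 :=
    pow_le_one₀ (l2OpNorm_nonneg _) l2OpNorm_lowerShift_le
  rw [← sq_le_sq₀ (norm_nonneg _) (norm_nonneg _), frobenius_sq, frobenius_sq]
  simp only [Fin.sum_univ_two, Finset.sum_add_distrib, nextGenerator, of_apply, cons_val_zero,
    cons_val_one, cons_val_fin_one]
  gcongr ?_ + _
  simp only [dotProduct, ← sq] at hshift
  exact hshift.trans (mul_le_of_le_one_left (by positivity) hcontract)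

lemma norm_computedR_le_norm_generator (hε : ε ≤ 1 / 10000) (n : ℕ) :
    ‖computedR A m G n‖ ≤ (1 + 360 * ε) * ‖generator A m G n‖ :=
  norm_qrFactor_le _ _ A (by linarith) m

lemma norm_generator_le (hε : ε ≤ 1 / 10000) (n : ℕ) :
    ‖generator A m G n‖ ≤ (1 + 360 * ε) ^ n * ‖G‖ := by
  have hε0 := A.nonneg
  induction n with
  | zero => simp [generator]
  | succ n ih =>
    calc ‖generator A m G (n + 1)‖ ≤ ‖computedR A m G n‖ := norm_nextGenerator_le A m _ _
      _ ≤ (1 + 360 * ε) * ‖generator A m G n‖ := norm_computedR_le_norm_generator A m G hε n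
      _ ≤ (1 + 360 * ε) * ((1 + 360 * ε) ^ n * ‖G‖) := by gcongr
      _ = (1 + 360 * ε) ^ (n + 1) * ‖G‖ := by ring

lemma growth_sq_le (hε0 : 0 ≤ ε) (hε : (d + 1) * ε ≤ 1 / 10000) {n : ℕ} (hn : n ≤ d + 1) :
    ((1 + 360 * ε) ^ n) ^ 2 ≤ 2 := by
  have hnd : (n : ℝ) * ε ≤ (d + 1) * ε := by
    gcongr
    exact_mod_cast hn
  have hcast : ((n * 2 : ℕ) : ℝ) * (360 * ε) = 720 * (n * ε) := by
    push_cast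
    ring
  rw [← pow_mul]
  refine (one_add_pow_le (by positivity) ?_).trans ?_ <;> linarith

lemma norm_generator_sq_le (hε : (d + 1) * ε ≤ 1 / 10000) {n : ℕ} (hn : n ≤ d + 1) :
    ‖generator A m G n‖ ^ 2 ≤ 2 * ‖G‖ ^ 2 := by
  have hgen := norm_generator_le A m G (precision_le A.nonneg hε) n
  calc ‖generator A m G n‖ ^ 2 ≤ ((1 + 360 * ε) ^ n * ‖G‖) ^ 2 := by gcongr
    _ = ((1 + 360 * ε) ^ n) ^ 2 * ‖G‖ ^ 2 := mul_pow _ _ _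
    _ ≤ 2 * ‖G‖ ^ 2 := by
        gcongr
        exact growth_sq_le A.nonneg hε hn

lemma norm_computedR_sq_le (hε : (d + 1) * ε ≤ 1 / 10000) {n : ℕ} (hn : n < d + 1) :
    ‖computedR A m G n‖ ^ 2 ≤ 2 * ‖G‖ ^ 2 := by
  have hε0 := A.nonneg
  have hprec := precision_le A.nonneg hε
  calc ‖computedR A m G n‖ ^ 2 ≤ ((1 + 360 * ε) * ((1 + 360 * ε) ^ n * ‖G‖)) ^ 2 := by
        gcongr
        refine (norm_computedR_le_norm_generator A m G hprec n).trans ?_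
        gcongr
        exact norm_generator_le A m G hprec n
    _ = ((1 + 360 * ε) ^ (n + 1)) ^ 2 * ‖G‖ ^ 2 := by ring
    _ ≤ 2 * ‖G‖ ^ 2 := by
        gcongr
        exact growth_sq_le A.nonneg hε hn

lemma norm_computedU_sq_le (hε : (d + 1) * ε ≤ 1 / 10000) :
    ‖computedU A m G‖ ^ 2 ≤ 2 * (d + 1) * ‖G‖ ^ 2 := by
  rw [frobenius_sq, Finset.sum_comm]
  have hcolumn (k : Fin (d + 1)) : ∑ i, computedU A m G i k ^ 2 ≤ 2 * ‖G‖ ^ 2 := by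
    refine le_trans ?_ (norm_computedR_sq_le A m G hε k.isLt)
    rw [frobenius_sq]
    refine Finset.sum_le_sum fun i _ => ?_
    rw [Fin.sum_univ_two, computedU_apply]
    exact le_add_of_nonneg_right (sq_nonneg _)
  refine (Finset.sum_le_sum fun k _ => hcolumn k).trans_eq ?_
  simp only [Finset.sum_const, Finset.card_univ, Fintype.card_fin, nsmul_eq_mul]
  push_cast
  ring

lemma norm_step_error_le (hε : (d + 1) * ε ≤ 1 / 10000) {n : ℕ} (hn : n < d + 1) :
    ‖computedR A m G n * (computedR A m G n)ᵀ - generator A m G n * (generator A m G n)ᵀ‖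
      ≤ 2000 * ‖G‖ ^ 2 * ε := by
  have hε0 := A.nonneg
  calc _ ≤ 1000 * ε * ‖generator A m G n‖ ^ 2 :=
        norm_qrFactor_mul_transpose_sub_le _ _ A (precision_le A.nonneg hε) m
    _ ≤ 1000 * ε * (2 * ‖G‖ ^ 2) := by
        gcongr
        exact norm_generator_sq_le A m G hε hn.le
    _ = 2000 * ‖G‖ ^ 2 * ε := by ring

variable {G} {K : Matrix (Fin (d + 1)) (Fin (d + 1)) ℝ}

lemma norm_computedU_mul_transpose_sub_le (hε : (d + 1) * ε ≤ 1 / 10000)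
    (hK : K - lowerShift d * K * (lowerShift d)ᵀ = G * Gᵀ) :
    ‖computedU A m G * (computedU A m G)ᵀ - K‖ ≤ 2000 * (d + 1) ^ 2 * ‖G‖ ^ 2 * ε := by
  have hdisplacement : (computedU A m G * (computedU A m G)ᵀ - K)
        - lowerShift d * (computedU A m G * (computedU A m G)ᵀ - K) * (lowerShift d)ᵀ =
      ∑ n ∈ Finset.range (d + 1), (computedR A m G n * (computedR A m G n)ᵀ
        - generator A m G n * (generator A m G n)ᵀ) := by
    rw [Matrix.mul_sub, Matrix.sub_mul, sub_sub_sub_comm, hK,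
      displacement_computedU_mul_transpose, add_sub_cancel_left]
  refine (norm_le_of_displacement _).trans ?_
  rw [hdisplacement]
  calc _ ≤ ((d : ℝ) + 1) * ∑ _n ∈ Finset.range (d + 1), 2000 * ‖G‖ ^ 2 * ε := by
        gcongr
        exact norm_sum_le_of_le _ fun n hn =>
          norm_step_error_le A m G hε (Finset.mem_range.1 hn)
    _ = 2000 * (d + 1) ^ 2 * ‖G‖ ^ 2 * ε := by
        rw [Finset.sum_const, Finset.card_range, nsmul_eq_mul]
        push_cast
        ring

lemma computedL_apply_eq (hG : NoBreakdown A m G) (i k : Fin (d + 1)) :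
    ∃ δ : ℝ, |δ| ≤ ε ∧ computedL A m G i k = unitColumns (computedU A m G) i k * (1 + δ) := by
  obtain ⟨δ, hδ, h⟩ := A.div_err (computedU A m G i k) _ (hG k)
  exact ⟨δ, hδ, by rw [computedL, of_apply, h, unitColumns, mul_diagonal, div_eq_mul_inv]⟩

lemma norm_computedL_mul_computedH_sub_le (hG : NoBreakdown A m G) :
    ‖computedL A m G * computedH A m G - computedU A m G‖ ≤ ε * ‖computedU A m G‖ := by
  refine frobenius_le_of_abs_le A.nonneg fun i k => ?_
  obtain ⟨δ, hδ, h⟩ := computedL_apply_eq A m hG i k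
  have hentry : (computedL A m G * computedH A m G - computedU A m G) i k
      = δ * computedU A m G i k := by
    rw [Matrix.sub_apply, computedH, mul_diagonal, h, unitColumns, mul_diagonal]
    field_simp [hG k]
    ring
  rw [hentry, abs_mul]
  gcongr

lemma computedL_mul_computedH_sq_mul_transpose :
    computedL A m G * computedH A m G ^ 2 * (computedL A m G)ᵀ
      = (computedL A m G * computedH A m G) * (computedL A m G * computedH A m G)ᵀ := by
  rw [transpose_mul, show (computedH A m G)ᵀ = computedH A m G from diagonal_transpose _, sq]
  simp only [Matrix.mul_assoc]

lemma norm_computedL_mul_computedH_sq_sub_le (hε : (d + 1) * ε ≤ 1 / 10000)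
    (hK : K - lowerShift d * K * (lowerShift d)ᵀ = G * Gᵀ) (hG : NoBreakdown A m G) :
    ‖computedL A m G * computedH A m G ^ 2 * (computedL A m G)ᵀ - K‖
      ≤ 5000 * (d + 1) ^ 2 * ‖G‖ ^ 2 * ε := by
  have hε0 := A.nonneg
  have hprec := precision_le A.nonneg hε
  have hLH := norm_computedL_mul_computedH_sub_le A m hG
  have hdivision : ‖computedL A m G * computedH A m G ^ 2 * (computedL A m G)ᵀ
      - computedU A m G * (computedU A m G)ᵀ‖ ≤ 6 * (d + 1) * ‖G‖ ^ 2 * ε := by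
    rw [computedL_mul_computedH_sq_mul_transpose]
    calc _ ≤ ε * ‖computedU A m G‖ * (ε * ‖computedU A m G‖ + 2 * ‖computedU A m G‖) :=
          (norm_mul_transpose_sub_le _ _).trans (by gcongr)
      _ = ε * (ε + 2) * ‖computedU A m G‖ ^ 2 := by ring
      _ ≤ ε * 3 * (2 * (d + 1) * ‖G‖ ^ 2) := by
          gcongr
          · linarith
          · exact norm_computedU_sq_le A m G hε
      _ = 6 * (d + 1) * ‖G‖ ^ 2 * ε := by ring
  have hd : (d + 1 : ℝ) ≤ (d + 1) ^ 2 := le_self_pow₀ (by simp) two_ne_zero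
  calc _ ≤ 6 * (d + 1) * ‖G‖ ^ 2 * ε + 2000 * (d + 1) ^ 2 * ‖G‖ ^ 2 * ε :=
        (norm_sub_le_norm_sub_add_norm_sub _ _ _).trans
          (add_le_add hdivision (norm_computedU_mul_transpose_sub_le A m hε hK))
    _ ≤ 6 * (d + 1) ^ 2 * ‖G‖ ^ 2 * ε + 2000 * (d + 1) ^ 2 * ‖G‖ ^ 2 * ε := by gcongr
    _ = 2006 * ((d + 1) ^ 2 * ‖G‖ ^ 2 * ε) := by ring
    _ ≤ 5000 * ((d + 1) ^ 2 * ‖G‖ ^ 2 * ε) := by gcongr; norm_num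
    _ = 5000 * (d + 1) ^ 2 * ‖G‖ ^ 2 * ε := by ring

end BackwardError

section ForwardError

variable {ε : ℝ} (A : FloatArith ε) (m : QRMethod) {d : ℕ}

/-- The algorithm, run on the generator `G` of `K`, does not break down, and the computed `L̂` is
within distance `b` of the factor `L` of the LDL decomposition of `K`. -/
def HasForwardError (K : Matrix (Fin (d + 1)) (Fin (d + 1)) ℝ)
    (G : Matrix (Fin (d + 1)) (Fin 2) ℝ) (b : ℝ) : Prop :=
  NoBreakdown A m G ∧ ∀ (L : Matrix (Fin (d + 1)) (Fin (d + 1)) ℝ) (δ : Fin (d + 1) → ℝ),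
    IsLDL K L δ → ‖computedL A m G - L‖ ≤ b

variable {A m} {K : Matrix (Fin (d + 1)) (Fin (d + 1)) ℝ} {G : Matrix (Fin (d + 1)) (Fin 2) ℝ}

lemma HasForwardError.mono {b c : ℝ} (h : HasForwardError A m K G b) (hbc : b ≤ c) :
    HasForwardError A m K G c :=
  ⟨h.1, fun L δ hL => (h.2 L δ hL).trans hbc⟩

lemma one_le_of_spectrum {s : ℝ} (hK : (K - 1).PosSemidef) (hKs : (s • 1 - K).PosSemidef) :
    1 ≤ s := by
  have hlower : 0 ≤ (K - 1) 0 0 := hK.diag_nonneg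
  have hupper : 0 ≤ (s • 1 - K) 0 0 := hKs.diag_nonneg
  simp only [Matrix.sub_apply, one_apply_eq, Matrix.smul_apply, smul_eq_mul] at hlower hupper
  linarith

lemma one_le_norm_generator_sq (hG : K - lowerShift d * K * (lowerShift d)ᵀ = G * Gᵀ)
    (hK : (K - 1).PosSemidef) : 1 ≤ ‖G‖ ^ 2 := by
  have hshift : (lowerShift d * K * (lowerShift d)ᵀ) 0 0 = 0 := by
    simp [Matrix.mul_apply, lowerShift]
  calc (1 : ℝ) ≤ K 0 0 := by
        simpa only [Matrix.sub_apply, one_apply_eq, sub_nonneg] using hK.diag_nonneg (i := 0)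
    _ = (G * Gᵀ) 0 0 := by rw [← hG, Matrix.sub_apply, hshift, sub_zero]
    _ = ∑ j, G 0 j ^ 2 := by simp only [Matrix.mul_apply, transpose_apply, sq]
    _ ≤ ‖G‖ ^ 2 := by
        rw [frobenius_sq]
        exact Finset.single_le_sum (f := fun i => ∑ j, G i j ^ 2) (fun i _ => by positivity)
          (Finset.mem_univ 0)

lemma norm_computedL_sub_unitColumns_le (hG : NoBreakdown A m G) :
    ‖computedL A m G - unitColumns (computedU A m G)‖ ≤ ε * ‖unitColumns (computedU A m G)‖ := by
  refine frobenius_le_of_abs_le A.nonneg fun i k => ?_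
  obtain ⟨δ, hδ, h⟩ := computedL_apply_eq A m hG i k
  rw [Matrix.sub_apply, h, mul_one_add, add_sub_cancel_left, mul_comm, abs_mul]
  gcongr

lemma norm_unitColumns_computedU_le (hε : (d + 1) * ε ≤ 1 / 10000) (hG : 1 ≤ ‖G‖ ^ 2)
    (hU : ∀ x, 1 / 2 * (x ⬝ᵥ x) ≤ x ⬝ᵥ ((computedU A m G * (computedU A m G)ᵀ) *ᵥ x)) :
    ‖unitColumns (computedU A m G)‖ ≤ 2 * (d + 1) * ‖G‖ ^ 2 := by
  have hunit := isUnit_det_of_le_mul_transpose one_half_pos hU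
  have hinv : l2OpNorm (computedU A m G)⁻¹ ^ 2 ≤ 2 := by
    rw [← Real.le_sqrt (l2OpNorm_nonneg _) zero_le_two]
    simpa using l2OpNorm_inv_le_of_le_mul_transpose one_half_pos hU
  have hdG : 1 ≤ (d + 1) * ‖G‖ ^ 2 := one_le_mul_of_one_le_of_one_le (by simp) hG
  rw [← sq_le_sq₀ (norm_nonneg _) (by positivity)]
  calc ‖unitColumns (computedU A m G)‖ ^ 2
      ≤ (l2OpNorm (computedU A m G)⁻¹ * ‖computedU A m G‖) ^ 2 := by
        gcongr
        exact norm_mul_diagonal_inv_le (computedU_isLowerTriangular A m G) hunit _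
    _ = l2OpNorm (computedU A m G)⁻¹ ^ 2 * ‖computedU A m G‖ ^ 2 := mul_pow _ _ _
    _ ≤ 2 * (2 * (d + 1) * ‖G‖ ^ 2) := by
        gcongr
        exact norm_computedU_sq_le A m G hε
    _ = 4 * ((d + 1) * ‖G‖ ^ 2) := by ring
    _ ≤ 4 * ((d + 1) * ‖G‖ ^ 2) ^ 2 := by gcongr; exact le_self_pow₀ hdG two_ne_zero
    _ = (2 * (d + 1) * ‖G‖ ^ 2) ^ 2 := by ring

variable (A m)

lemma hasForwardError (hG : K - lowerShift d * K * (lowerShift d)ᵀ = G * Gᵀ) {s : ℝ}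
    (hK : (K - 1).PosSemidef) (hKs : (s • 1 - K).PosSemidef)
    (hsmall : (d + 1) ^ 2 * ‖G‖ ^ 2 * ε ≤ 1 / 10000) :
    HasForwardError A m K G (5000 * (d + 1) ^ 2 * √s * ‖G‖ ^ 2 * ε) := by
  have hε0 := A.nonneg
  have hG1 := one_le_norm_generator_sq hG hK
  have hs1 := one_le_of_spectrum hK hKs
  have hd : (d + 1 : ℝ) ≤ (d + 1) ^ 2 := le_self_pow₀ (by simp) two_ne_zero
  have hε : (d + 1) * ε ≤ 1 / 10000 :=
    calc (d + 1) * ε ≤ (d + 1) ^ 2 * ‖G‖ ^ 2 * ε := by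
          gcongr
          exact hd.trans (le_mul_of_one_le_right (by positivity) hG1)
      _ ≤ 1 / 10000 := hsmall
  have hresidual := norm_computedU_mul_transpose_sub_le A m hε hG
  have hhalf : ‖computedU A m G * (computedU A m G)ᵀ - K‖ ≤ 1 / 2 := by linarith
  have hdefinite := half_le_of_norm_sub_le hK hhalf
  have hbreakdown : NoBreakdown A m G := apply_self_ne_zero_of_isLowerTriangular
    (computedU_isLowerTriangular A m G) (isUnit_det_of_le_mul_transpose one_half_pos hdefinite)
  have hcolumns : ‖unitColumns (computedU A m G)‖ ≤ 2 * (d + 1) ^ 2 * ‖G‖ ^ 2 :=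
    (norm_unitColumns_computedU_le hε hG1 hdefinite).trans (by gcongr)
  refine ⟨hbreakdown, fun L δ hL => ?_⟩
  calc ‖computedL A m G - L‖
      ≤ ‖computedL A m G - unitColumns (computedU A m G)‖ + ‖unitColumns (computedU A m G) - L‖ :=
        norm_sub_le_norm_sub_add_norm_sub _ _ _
    _ ≤ ε * ‖unitColumns (computedU A m G)‖
          + 2 * √s * ‖computedU A m G * (computedU A m G)ᵀ - K‖ :=
        add_le_add (norm_computedL_sub_unitColumns_le hbreakdown) (hL.norm_unitColumns_sub_le
          (zero_le_one.trans hs1) hK hKs (computedU_isLowerTriangular A m G) hhalf)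
    _ ≤ ε * (2 * (d + 1) ^ 2 * ‖G‖ ^ 2) + 2 * √s * (2000 * (d + 1) ^ 2 * ‖G‖ ^ 2 * ε) := by gcongr
    _ ≤ ε * (2 * (d + 1) ^ 2 * ‖G‖ ^ 2) * √s + 2 * √s * (2000 * (d + 1) ^ 2 * ‖G‖ ^ 2 * ε) := by
        gcongr ?_ + _
        exact le_mul_of_one_le_right (by positivity) (Real.one_le_sqrt.2 hs1)
    _ = 4002 * ((d + 1) ^ 2 * √s * ‖G‖ ^ 2 * ε) := by ring
    _ ≤ 5000 * ((d + 1) ^ 2 * √s * ‖G‖ ^ 2 * ε) := by gcongr; norm_num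
    _ = 5000 * (d + 1) ^ 2 * √s * ‖G‖ ^ 2 * ε := by ring

end ForwardError

section Toeplitz

open Polynomial Complex ComplexConjugate

lemma fourierCoeffOn_two_pi (φ : ℝ → ℂ) (k : ℤ) :
    fourierCoeffOn Real.two_pi_pos φ k =
      (1 / (2 * Real.pi) : ℝ) * ∫ t in (0 : ℝ)..(2 * Real.pi), φ t * exp (-(k * t * I)) := by
  rw [fourierCoeffOn_eq_integral, sub_zero, real_smul]
  congr 1
  refine intervalIntegral.integral_congr fun t _ => ?_
  simp only [fourier_coe_apply, smul_eq_mul]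
  rw [mul_comm]
  congr 2
  push_cast
  field_simp

lemma integral_exp_neg_mul_I {E : Type*} [NormedAddCommGroup E] [NormedSpace ℝ E] (F : ℂ → E) :
    ∫ t in (0 : ℝ)..(2 * Real.pi), F (exp (-(t * I))) =
      (2 * Real.pi) • Real.circleAverage F 0 1 := by
  rw [← Real.circleAverage_zero_one_congr_inv, Real.circleAverage_def,
    smul_inv_smul₀ Real.two_pi_pos.ne']
  simp only [circleMap, zero_add, ofReal_one, one_mul, exp_neg]

variable {n : ℕ}

lemma integral_norm_eval_ofFn_sq (x : Fin n → ℂ) :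
    ∫ t in (0 : ℝ)..(2 * Real.pi), ‖(ofFn n x).eval (exp (-(t * I)))‖ ^ 2 =
      2 * Real.pi * ∑ i, ‖x i‖ ^ 2 := by
  have hsupport : (ofFn n x).support ⊆ Finset.range n := fun i hi => by
    by_contra hn
    exact mem_support_iff.1 hi (ofFn_coeff_eq_zero_of_ge x (by simpa using hn))
  rw [integral_exp_neg_mul_I fun w => ‖(ofFn n x).eval w‖ ^ 2,
    ← sum_sq_norm_coeff_eq_circleAverage, smul_eq_mul,
    Finset.sum_subset hsupport fun i _ hi => by simp [notMem_support_iff.1 hi], Finset.sum_range]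
  simp only [Fin.is_lt, ofFn_coeff_eq_val_of_lt]

lemma eval_ofFn {R : Type*} [CommSemiring R] [DecidableEq R] (x : Fin n → R) (w : R) :
    (ofFn n x).eval w = ∑ i, x i * w ^ (i : ℕ) := by
  simp only [ofFn_eq_sum_monomial, eval_finsetSum, eval_monomial]

lemma sum_sum_mul_fourierCoeffOn {φ : ℝ → ℂ} (hφ : Continuous φ) (k : ℤ) (x y : Fin n → ℂ) :
    ∑ i, ∑ j, conj (y i) * x j * fourierCoeffOn Real.two_pi_pos φ (k - i + j) =
      (1 / (2 * Real.pi) : ℝ) * ∫ t in (0 : ℝ)..(2 * Real.pi), φ t * exp (-(k * t * I)) *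
        (conj ((ofFn n y).eval (exp (-(t * I)))) * (ofFn n x).eval (exp (-(t * I)))) := by
  have hexp (t : ℝ) (i j : Fin n) : exp (-((k - i + j : ℤ) * t * I)) =
      exp (-(k * t * I)) * (conj (exp (-(t * I)) ^ (i : ℕ)) * exp (-(t * I)) ^ (j : ℕ)) := by
    rw [← exp_nat_mul, ← exp_nat_mul, ← exp_conj, ← exp_add, ← exp_add]
    congr 1
    simp only [map_mul, map_neg, conj_I, conj_ofReal, map_natCast]
    push_cast
    ring
  have hintegrand (t : ℝ) : φ t * exp (-(k * t * I)) *
        (conj ((ofFn n y).eval (exp (-(t * I)))) * (ofFn n x).eval (exp (-(t * I)))) =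
      ∑ i, ∑ j, conj (y i) * x j * (φ t * exp (-((k - i + j : ℤ) * t * I))) := by
    rw [eval_ofFn, eval_ofFn, map_sum, Finset.sum_mul_sum]
    simp only [hexp, Finset.mul_sum, map_mul]
    refine Finset.sum_congr rfl fun i _ => Finset.sum_congr rfl fun j _ => ?_
    ring
  simp only [hintegrand, fourierCoeffOn_two_pi]
  rw [intervalIntegral.integral_finsetSum fun i _ =>
    Continuous.intervalIntegrable (by fun_prop) _ _, Finset.mul_sum]
  refine Finset.sum_congr rfl fun i _ => ?_
  rw [intervalIntegral.integral_finsetSum fun j _ =>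
    Continuous.intervalIntegrable (by fun_prop) _ _, Finset.mul_sum]
  refine Finset.sum_congr rfl fun j _ => ?_
  rw [intervalIntegral.integral_const_mul]
  ring

lemma norm_sum_sum_mul_fourierCoeffOn_le {φ : ℝ → ℂ} (hφ : Continuous φ) {s : ℝ}
    (hs : ∀ t, ‖φ t‖ ≤ s) (k : ℤ) (x y : Fin n → ℂ) :
    ‖∑ i, ∑ j, conj (y i) * x j * fourierCoeffOn Real.two_pi_pos φ (k - i + j)‖ ≤
      (s ^ 2 * ∑ i, ‖x i‖ ^ 2 + ∑ i, ‖y i‖ ^ 2) / 2 := by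
  set q : ℝ → ℂ := fun t => (ofFn n x).eval (exp (-(t * I)))
  set r : ℝ → ℂ := fun t => (ofFn n y).eval (exp (-(t * I)))
  have hq : Continuous q := (ofFn n x).continuous.comp (by fun_prop)
  have hr : Continuous r := (ofFn n y).continuous.comp (by fun_prop)
  have hpointwise (t : ℝ) : ‖φ t * exp (-(k * t * I)) * (conj (r t) * q t)‖
      ≤ s ^ 2 / 2 * ‖q t‖ ^ 2 + 1 / 2 * ‖r t‖ ^ 2 := by
    have hunit : ‖exp (-(k * t * I))‖ = 1 := by simp [norm_exp]
    have hφq : ‖φ t‖ * ‖q t‖ ≤ s * ‖q t‖ := by gcongr; exact hs t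
    rw [norm_mul, norm_mul, norm_mul, hunit, mul_one, norm_conj]
    nlinarith [sq_nonneg (s * ‖q t‖ - ‖r t‖), norm_nonneg (r t)]
  have hintegral : ‖∫ t in (0 : ℝ)..(2 * Real.pi), φ t * exp (-(k * t * I)) * (conj (r t) * q t)‖
      ≤ s ^ 2 / 2 * (2 * Real.pi * ∑ i, ‖x i‖ ^ 2)
        + 1 / 2 * (2 * Real.pi * ∑ i, ‖y i‖ ^ 2) := by
    rw [← integral_norm_eval_ofFn_sq, ← integral_norm_eval_ofFn_sq,
      ← intervalIntegral.integral_const_mul, ← intervalIntegral.integral_const_mul,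
      ← intervalIntegral.integral_add (Continuous.intervalIntegrable (by fun_prop) _ _)
        (Continuous.intervalIntegrable (by fun_prop) _ _)]
    exact intervalIntegral.norm_integral_le_of_norm_le Real.two_pi_pos.le
      (.of_forall fun t _ => hpointwise t) (Continuous.intervalIntegrable (by fun_prop) _ _)
  rw [sum_sum_mul_fourierCoeffOn hφ, norm_mul, norm_real, Real.norm_of_nonneg (by positivity),
    one_div, inv_mul_le_iff₀ Real.two_pi_pos]
  exact hintegral.trans_eq (by ring)

lemma l2OpNorm_le_of_fourierCoeffOn {φ : ℝ → ℂ} (hφ : Continuous φ) {s : ℝ} (hs : ∀ t, ‖φ t‖ ≤ s)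
    (k : ℤ) {T : Matrix (Fin n) (Fin n) ℝ}
    (hT : ∀ i j, T i j = (fourierCoeffOn Real.two_pi_pos φ (k - i + j)).re) : l2OpNorm T ≤ s := by
  refine l2OpNorm_le_of_mulVec_dotProduct_self_le ((norm_nonneg _).trans (hs 0)) fun x => ?_
  set y := T *ᵥ x with hy
  have hform : y ⬝ᵥ y = (∑ i, ∑ j, conj (y i : ℂ) * (x j : ℂ) *
      fourierCoeffOn Real.two_pi_pos φ (k - i + j)).re := by
    nth_rewrite 2 [hy]
    simp only [re_sum, conj_ofReal, ← ofReal_mul, re_ofReal_mul, ← hT, dotProduct, mulVec,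
      Finset.mul_sum]
    exact Finset.sum_congr rfl fun i _ => Finset.sum_congr rfl fun j _ => by ring
  have hbound := hform.trans_le <| (re_le_norm _).trans <|
    norm_sum_sum_mul_fourierCoeffOn_le hφ hs k (fun j => (x j : ℂ)) fun i => (y i : ℂ)
  simp only [norm_real, Real.norm_eq_abs, sq_abs] at hbound
  simp only [dotProduct, ← sq] at hbound ⊢
  linarith

end Toeplitz

section DisplacementToeplitz

variable {d : ℕ}

lemma lowerShift_mul_apply (M : Matrix (Fin (d + 1)) (Fin (d + 1)) ℝ) (i j : Fin (d + 1)) :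
    (lowerShift d * M) i j = Fin.cases 0 (fun i => M i.castSucc j) i :=
  lowerShift_mulVec (fun k => M k j) i

lemma mul_lowerShift_apply_castSucc (M : Matrix (Fin (d + 1)) (Fin (d + 1)) ℝ) (i : Fin (d + 1))
    (j : Fin d) : (M * lowerShift d) i j.castSucc = M i j.succ := by
  rw [Matrix.mul_apply, Finset.sum_eq_single j.succ]
  · simp [lowerShift]
  · intro k _ hk
    have hkj : (k : ℕ) ≠ j + 1 := fun h => hk (Fin.ext h)
    simp [lowerShift, hkj]
  · simp

lemma mul_lowerShift_apply_last (M : Matrix (Fin (d + 1)) (Fin (d + 1)) ℝ) (i : Fin (d + 1)) :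
    (M * lowerShift d) i (Fin.last d) = 0 := by
  rw [Matrix.mul_apply]
  refine Finset.sum_eq_zero fun k _ => ?_
  simp [lowerShift, k.isLt.ne]

lemma one_sub_lowerShift_mul_transpose :
    1 - lowerShift d * (lowerShift d)ᵀ = vecMulVec (Pi.single 0 1) (Pi.single 0 1) := by
  ext i j
  rw [Matrix.sub_apply, lowerShift_mul_apply, vecMulVec_apply]
  cases i using Fin.cases <;> cases j using Fin.cases <;>
    simp [lowerShift, Matrix.one_apply, Fin.ext_iff, eq_comm]

lemma lowerToeplitz_eq_zero_of_lt (p : Fin (d + 1) → ℝ) {i j : Fin (d + 1)} (h : i < j) :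
    lowerToeplitz p i j = 0 := by
  simp [lowerToeplitz, h]

lemma lowerToeplitz_succ_succ (p : Fin (d + 1) → ℝ) (i j : Fin d) :
    lowerToeplitz p i.succ j.succ = lowerToeplitz p i.castSucc j.castSucc := by
  simp only [lowerToeplitz, of_apply, Fin.succ_le_succ_iff, Fin.castSucc_le_castSucc_iff]
  split_ifs with h
  · congr 1
    ext
    rw [Fin.sub_val_of_le (by simpa using h), Fin.sub_val_of_le (by simpa using h)]
    simp
  · rfl

lemma lowerShift_mul_lowerToeplitz (p : Fin (d + 1) → ℝ) :
    lowerShift d * lowerToeplitz p = lowerToeplitz p * lowerShift d := by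
  ext i j
  rw [lowerShift_mul_apply]
  cases j using Fin.lastCases with
  | last =>
    rw [mul_lowerShift_apply_last]
    cases i using Fin.cases with
    | zero => rfl
    | succ i => exact lowerToeplitz_eq_zero_of_lt p i.castSucc_lt_last
  | cast j =>
    rw [mul_lowerShift_apply_castSucc]
    cases i using Fin.cases with
    | zero => exact (lowerToeplitz_eq_zero_of_lt p j.succ_pos).symm
    | succ i => exact (lowerToeplitz_succ_succ p i j).symm

lemma lowerToeplitz_mulVec_single_zero (p : Fin (d + 1) → ℝ) :
    lowerToeplitz p *ᵥ Pi.single 0 1 = p := by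
  ext i
  simp [lowerToeplitz]

lemma startGenerator_mul_transpose (p : Fin (d + 1) → ℝ) :
    startGenerator p * (startGenerator p)ᵀ =
      vecMulVec (Pi.single 0 1) (Pi.single 0 1) + vecMulVec p p := by
  ext i j
  simp [Matrix.mul_apply, Fin.sum_univ_two, startGenerator, vecMulVec_apply, Pi.single_apply]

lemma displacement_one_add_lowerToeplitz (p : Fin (d + 1) → ℝ) :
    (1 + lowerToeplitz p * (lowerToeplitz p)ᵀ)
        - lowerShift d * (1 + lowerToeplitz p * (lowerToeplitz p)ᵀ) * (lowerShift d)ᵀ =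
      startGenerator p * (startGenerator p)ᵀ := by
  have hconj : lowerShift d * (lowerToeplitz p * (lowerToeplitz p)ᵀ) * (lowerShift d)ᵀ =
      lowerToeplitz p * (lowerShift d * (lowerShift d)ᵀ) * (lowerToeplitz p)ᵀ := by
    rw [← Matrix.mul_assoc, Matrix.mul_assoc, ← transpose_mul, lowerShift_mul_lowerToeplitz,
      transpose_mul]
    simp only [Matrix.mul_assoc]
  calc _ = (1 - lowerShift d * (lowerShift d)ᵀ)
        + lowerToeplitz p * (1 - lowerShift d * (lowerShift d)ᵀ) * (lowerToeplitz p)ᵀ := by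
        rw [Matrix.mul_add, Matrix.add_mul, hconj, Matrix.mul_sub, Matrix.sub_mul]
        simp only [Matrix.mul_one]
        abel
    _ = _ := by
        rw [one_sub_lowerShift_mul_transpose, mul_vecMulVec, vecMulVec_mul, vecMul_transpose,
          lowerToeplitz_mulVec_single_zero, startGenerator_mul_transpose]

end DisplacementToeplitz

section QuantumSignalProcessing

open Polynomial Complex

lemma expand_contract_of_comp_neg_X {R : Type*} [CommRing R] [IsDomain R] [CharZero R] {f : R[X]}
    (hf : f.comp (-X) = f) : expand R 2 (contract 2 f) = f := by
  ext n
  rw [coeff_expand two_pos]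
  split_ifs with hn
  · rw [coeff_contract two_ne_zero, Nat.div_mul_cancel hn]
  · have hodd : Odd n := by rwa [← Nat.not_even_iff_odd, even_iff_two_dvd]
    have hcoeff : (f.comp (C (-1) * X)).coeff n = f.coeff n := by rw [C_neg, C_1, neg_one_mul, hf]
    rw [comp_C_mul_X_coeff, hodd.neg_one_pow, mul_neg_one] at hcoeff
    exact (CharZero.neg_eq_self_iff.1 hcoeff).symm

lemma exp_neg_mul_I_mul_cos_half_sq (t : ℝ) :
    exp (-(t * I)) * (Real.cos (t / 2) : ℂ) ^ 2 = (1 + exp (-(t * I))) ^ 2 / 4 := by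
  have hsq : exp (-(t * I)) = exp (-(t / 2) * I) ^ 2 := by
    rw [← exp_nat_mul]
    congr 1
    push_cast
    ring
  have hinv : exp (t / 2 * I) * exp (-(t / 2) * I) = 1 := by
    rw [← exp_add, neg_mul, add_neg_cancel, exp_zero]
  rw [ofReal_cos, cos, hsq]
  push_cast
  set u := exp (t / 2 * I)
  set v := exp (-(t / 2) * I)
  linear_combination (u * v + 1 + 2 * v ^ 2) / 4 * hinv

variable {d : ℕ} {η : ℝ} {f : ℝ[X]} {P : ℂ[X]}

lemma IsTarget.exists_eval_exp_eq (hf : IsTarget d η f) :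
    ∃ N : ℂ[X], ∀ t : ℝ,
      N.eval (exp (-(t * I))) = exp (-(t * I)) ^ d * ((f.eval (Real.cos (t / 2)) : ℝ) : ℂ) := by
  obtain ⟨g, hg⟩ : ∃ g, expand ℝ 2 g = f := ⟨_, expand_contract_of_comp_neg_X hf.2.1⟩
  have hdeg : g.natDegree < d + 1 := by
    have hfdeg := hf.1
    rw [← hg, natDegree_expand] at hfdeg
    omega
  refine ⟨∑ l ∈ Finset.range (d + 1),
    C (g.coeff l : ℂ) * (X ^ (d - l) * (C (1 / 4) * (1 + X) ^ 2) ^ l), fun t => ?_⟩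
  rw [← hg, expand_eval, eval_eq_sum_range' hdeg, eval_finsetSum, ofReal_sum, Finset.mul_sum]
  refine Finset.sum_congr rfl fun l hl => ?_
  have hl : d - l + l = d := Nat.sub_add_cancel (Nat.lt_succ_iff.1 (Finset.mem_range.1 hl))
  simp only [eval_mul, eval_C, eval_pow, eval_X, eval_add, eval_one]
  rw [one_div_mul_eq_div, ← exp_neg_mul_I_mul_cos_half_sq, mul_pow, ← mul_assoc (_ ^ (d - l)),
    ← pow_add, hl]
  push_cast
  ring

lemma IsTarget.eval_sq_le (hf : IsTarget d η f) (hη : 0 ≤ η) (t : ℝ) :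
    f.eval (Real.cos (t / 2)) ^ 2 ≤ 1 - η := by
  have h := hf.2.2 _ ⟨Real.neg_one_le_cos (t / 2), Real.cos_le_one (t / 2)⟩
  rw [← sq_abs]
  nlinarith [abs_nonneg (f.eval (Real.cos (t / 2)))]

lemma IsOuterComplement.le_norm_eval_exp_sq (hP : IsOuterComplement f P) (hf : IsTarget d η f)
    (hη : 0 ≤ η) (t : ℝ) : η ≤ ‖P.eval (exp (-(t * I)))‖ ^ 2 := by
  linarith [hP.2.2 t, hf.eval_sq_le hη t]

lemma IsOuterComplement.eval_exp_ne_zero (hP : IsOuterComplement f P) (hf : IsTarget d η f)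
    (hη : 0 < η) (t : ℝ) : P.eval (exp (-(t * I))) ≠ 0 := fun h => by
  have hle := hP.le_norm_eval_exp_sq hf hη.le t
  rw [h, norm_zero, zero_pow two_ne_zero] at hle
  exact hle.not_gt hη

lemma IsOuterComplement.eval_ne_zero (hP : IsOuterComplement f P) (hf : IsTarget d η f)
    (hη : 0 < η) {w : ℂ} (hw : ‖w‖ ≤ 1) : P.eval w ≠ 0 := by
  rcases hw.lt_or_eq with hw | hw
  · exact hP.1 w hw
  · obtain ⟨t, rfl⟩ := (norm_eq_one_iff w).1 hw
    simpa using hP.eval_exp_ne_zero hf hη (-t)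

/-- The function `b / (i a)` on the unit circle, in the variable `t` with `z = e^{it}`. -/
noncomputable def symbol (f : ℝ[X]) (P : ℂ[X]) (t : ℝ) : ℂ :=
  ((f.eval (Real.cos (t / 2)) : ℝ) : ℂ) / P.eval (exp (-(t * I)))

lemma neg_I_mul_laurentCoeff (k : ℤ) :
    -I * laurentCoeff f P k = fourierCoeffOn Real.two_pi_pos (symbol f P) k := by
  rw [fourierCoeffOn_two_pi, laurentCoeff, mul_left_comm, ← intervalIntegral.integral_const_mul]
  congr 2
  funext t
  rw [symbol]
  linear_combination -(((f.eval (Real.cos (t / 2)) : ℝ) : ℂ) / P.eval (exp (-(t * I)))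
    * exp (-(k * t * I))) * I_mul_I

lemma continuous_symbol (hf : IsTarget d η f) (hP : IsOuterComplement f P) (hη : 0 < η) :
    Continuous (symbol f P) := by
  have hnum : Continuous fun t : ℝ => ((f.eval (Real.cos (t / 2)) : ℝ) : ℂ) :=
    continuous_ofReal.comp (f.continuous.comp (by fun_prop))
  exact hnum.div (P.continuous.comp (by fun_prop)) (hP.eval_exp_ne_zero hf hη)

lemma norm_symbol_le (hf : IsTarget d η f) (hP : IsOuterComplement f P) (hη : 0 < η) (t : ℝ) :
    ‖symbol f P t‖ ≤ √(η⁻¹ - 1) := by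
  have hle := hP.le_norm_eval_exp_sq hf hη.le t
  have hPpos := hη.trans_le hle
  refine Real.le_sqrt_of_sq_le ?_
  calc ‖symbol f P t‖ ^ 2
      = (1 - ‖P.eval (exp (-(t * I)))‖ ^ 2) / ‖P.eval (exp (-(t * I)))‖ ^ 2 := by
        rw [symbol, norm_div, div_pow, norm_real, Real.norm_eq_abs, sq_abs, ← hP.2.2 t,
          add_sub_cancel_left]
    _ = (‖P.eval (exp (-(t * I)))‖ ^ 2)⁻¹ - 1 := by rw [sub_div, div_self hPpos.ne', one_div]
    _ ≤ η⁻¹ - 1 := by gcongr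

/-- After multiplication by `z^{-d}` the function `b / a` is holomorphic on `{|z| ≥ 1} ∪ {∞}`. -/
lemma fourierCoeffOn_symbol_eq_zero (hf : IsTarget d η f) (hP : IsOuterComplement f P) (hη : 0 < η)
    {k : ℕ} (hk : d < k) : fourierCoeffOn Real.two_pi_pos (symbol f P) k = 0 := by
  obtain ⟨N, hN⟩ := hf.exists_eval_exp_eq
  set F : ℂ → ℂ := fun w => N.eval w / P.eval w * w ^ (k - d)
  have hF : DiffContOnCl ℂ F (Metric.ball 0 |1|) := by
    rw [abs_one]
    refine DifferentiableOn.diffContOnCl_ball (U := Metric.closedBall 0 1) (fun w hw => ?_)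
      subset_rfl
    have hPw := hP.eval_ne_zero hf hη (mem_closedBall_zero_iff.1 hw)
    have hNd := N.differentiable w
    have hPd := P.differentiable w
    exact DifferentiableAt.differentiableWithinAt (by fun_prop (disch := assumption))
  have hzero : F 0 = 0 := by simp [F, Nat.sub_ne_zero_of_lt hk]
  have hintegrand (t : ℝ) : symbol f P t * exp (-((k : ℤ) * t * I)) = F (exp (-(t * I))) := by
    have hexp : exp (-((k : ℤ) * t * I)) = exp (-(t * I)) ^ d * exp (-(t * I)) ^ (k - d) := by
      rw [← pow_add, Nat.add_sub_cancel' hk.le, ← exp_nat_mul]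
      congr 1
      push_cast
      ring
    simp only [F, hN, symbol, hexp]
    ring
  rw [fourierCoeffOn_two_pi]
  simp only [hintegrand]
  rw [integral_exp_neg_mul_I, hF.circleAverage, hzero, smul_zero, mul_zero]

lemma lowerToeplitz_pVec_apply (hf : IsTarget d η f) (hP : IsOuterComplement f P) (hη : 0 < η)
    (i j : Fin (d + 1)) : lowerToeplitz (pVec d f P) i j =
      (fourierCoeffOn Real.two_pi_pos (symbol f P) (d - i + j)).re := by
  rw [lowerToeplitz, of_apply]
  split_ifs with h
  · rw [pVec, neg_I_mul_laurentCoeff, Fin.sub_val_of_le h, Nat.cast_sub h, sub_sub_eq_add_sub,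
      sub_add_eq_add_sub]
  · have hindex : (d - i + j : ℤ) = (d + (j - i) : ℕ) := by
      push_cast [Nat.cast_sub (not_le.1 h).le]
      ring
    rw [hindex, fourierCoeffOn_symbol_eq_zero hf hP hη, zero_re]
    exact Nat.lt_add_of_pos_right (Nat.sub_pos_of_lt (not_le.1 h))

lemma l2OpNorm_lowerToeplitz_pVec_le (hf : IsTarget d η f) (hP : IsOuterComplement f P)
    (hη : 0 < η) : l2OpNorm (lowerToeplitz (pVec d f P)) ≤ √(η⁻¹ - 1) :=
  l2OpNorm_le_of_fourierCoeffOn (continuous_symbol hf hP hη) (norm_symbol_le hf hP hη) d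
    (lowerToeplitz_pVec_apply hf hP hη)

lemma posSemidef_inv_smul_one_sub (hf : IsTarget d η f) (hP : IsOuterComplement f P) (hη : 0 < η) :
    (η⁻¹ • 1 - (1 + lowerToeplitz (pVec d f P) * (lowerToeplitz (pVec d f P))ᵀ)).PosSemidef := by
  have hη1 : η ≤ 1 := sub_nonneg.1 ((sq_nonneg _).trans (hf.eval_sq_le hη.le 0))
  have hgram := (posSemidef_smul_one_sub_mul_transpose_iff (Real.sqrt_nonneg _)).2
    (l2OpNorm_lowerToeplitz_pVec_le hf hP hη)
  rwa [Real.sq_sqrt (sub_nonneg.2 ((one_le_inv₀ hη).2 hη1)), sub_smul, one_smul, sub_sub] at hgram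

end QuantumSignalProcessing

section SharpBounds

variable {d : ℕ} {ε η : ℝ} {A : FloatArith ε} {m : QRMethod}

lemma hasForwardError_one_add_lowerToeplitz_pVec {f : Polynomial ℝ} {P : Polynomial ℂ}
    (hη : 0 < η) (hf : IsTarget d η f) (hP : IsOuterComplement f P)
    (hsmall : (d + 1) ^ 2 * ‖startGenerator (pVec d f P)‖ ^ 2 * ε ≤ 1 / 10000) :
    HasForwardError A m (1 + lowerToeplitz (pVec d f P) * (lowerToeplitz (pVec d f P))ᵀ)
      (startGenerator (pVec d f P))
      (5000 * (d + 1) ^ 2 * √η⁻¹ * ‖startGenerator (pVec d f P)‖ ^ 2 * ε) := by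
  have hlower :
      (1 + lowerToeplitz (pVec d f P) * (lowerToeplitz (pVec d f P))ᵀ - 1).PosSemidef := by
    rw [add_sub_cancel_left]
    exact posSemidef_self_mul_conjTranspose _
  exact hasForwardError A m (displacement_one_add_lowerToeplitz _) hlower
    (posSemidef_inv_smul_one_sub hf hP hη) hsmall

lemma succ_sq_le_four_mul_cube (hd : 1 ≤ d) : ((d : ℝ) + 1) ^ 2 ≤ 4 * (d : ℝ) ^ 3 := by
  have hd1 : (1 : ℝ) ≤ d := by exact_mod_cast hd
  calc ((d : ℝ) + 1) ^ 2 ≤ (2 * d) ^ 2 := by gcongr; linarith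
    _ = 4 * (d : ℝ) ^ 2 := by ring
    _ ≤ 4 * (d : ℝ) ^ 3 := by gcongr; norm_num

lemma HasForwardError.of_sharp {K : Matrix (Fin (d + 1)) (Fin (d + 1)) ℝ}
    {G : Matrix (Fin (d + 1)) (Fin 2) ℝ} {C c : ℝ} (hd : 1 ≤ d) (hC : 0 ≤ C) (hc : 0 ≤ c)
    (hη : 0 < η) (hη1 : η ≤ 1)
    (h : (d + 1) ^ 2 * ‖G‖ ^ 2 * ε ≤ c →
      HasForwardError A m K G (C * (d + 1) ^ 2 * √η⁻¹ * ‖G‖ ^ 2 * ε))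
    (hsmall : (d : ℝ) ^ 3 * ‖G‖ ^ 2 * ε ≤ c / 4 * √η) :
    HasForwardError A m K G (4 * C * (d : ℝ) ^ 3 * η⁻¹ * ‖G‖ ^ 2 * ε) := by
  have hε := A.nonneg
  have hdim := succ_sq_le_four_mul_cube hd
  have hroot : √η⁻¹ ≤ η⁻¹ :=
    (Real.sqrt_le_left (inv_nonneg.2 hη.le)).2 (le_self_pow₀ ((one_le_inv₀ hη).2 hη1) two_ne_zero)
  refine (h ?_).mono ?_
  · calc (d + 1) ^ 2 * ‖G‖ ^ 2 * ε ≤ 4 * (d : ℝ) ^ 3 * ‖G‖ ^ 2 * ε := by gcongr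
      _ = 4 * ((d : ℝ) ^ 3 * ‖G‖ ^ 2 * ε) := by ring
      _ ≤ 4 * (c / 4 * √η) := by gcongr
      _ ≤ 4 * (c / 4 * 1) := by gcongr; exact Real.sqrt_le_one.2 hη1
      _ = c := by ring
  · calc C * (d + 1) ^ 2 * √η⁻¹ * ‖G‖ ^ 2 * ε
        ≤ C * (4 * (d : ℝ) ^ 3) * η⁻¹ * ‖G‖ ^ 2 * ε := by gcongr
      _ = 4 * C * (d : ℝ) ^ 3 * η⁻¹ * ‖G‖ ^ 2 * ε := by ring

lemma backward_bound_le {C x : ℝ} (hd : 1 ≤ d) (hC : 0 ≤ C) (hε : 0 ≤ ε) :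
    C * (d + 1) ^ 2 * x ^ 2 * ε ≤ 4 * C * (d : ℝ) ^ 3 * x ^ 2 * ε := by
  calc C * (d + 1) ^ 2 * x ^ 2 * ε ≤ C * (4 * (d : ℝ) ^ 3) * x ^ 2 * ε := by
        gcongr
        exact succ_sq_le_four_mul_cube hd
    _ = 4 * C * (d : ℝ) ^ 3 * x ^ 2 * ε := by ring

end SharpBounds

end HalfCholesky

theorem theorem3_general :
    ∃ C c : ℝ, 0 < C ∧ 0 < c ∧ ∀ (d : ℕ) (ε : ℝ) (A : FloatArith ε) (m : QRMethod),
      (∀ (K : Matrix (Fin (d + 1)) (Fin (d + 1)) ℝ) (G : Matrix (Fin (d + 1)) (Fin 2) ℝ),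
        K - lowerShift d * K * (lowerShift d)ᵀ = G * Gᵀ →
          ((d + 1) * ε ≤ c → NoBreakdown A m G →
            ‖computedL A m G * computedH A m G ^ 2 * (computedL A m G)ᵀ - K‖
              ≤ C * (d + 1) ^ 2 * ‖G‖ ^ 2 * ε) ∧
          (∀ η : ℝ, (K - 1).PosSemidef → (η⁻¹ • 1 - K).PosSemidef →
            (d + 1) ^ 2 * ‖G‖ ^ 2 * ε ≤ c →
              HasForwardError A m K G (C * (d + 1) ^ 2 * √η⁻¹ * ‖G‖ ^ 2 * ε))) ∧
      (∀ (η : ℝ) (f : Polynomial ℝ) (P : Polynomial ℂ), 0 < η →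
        IsTarget d η f → IsOuterComplement f P →
        ∀ (B K : Matrix (Fin (d + 1)) (Fin (d + 1)) ℝ) (G : Matrix (Fin (d + 1)) (Fin 2) ℝ),
          B = lowerToeplitz (pVec d f P) → K = 1 + B * Bᵀ → G = startGenerator (pVec d f P) →
          (d + 1) ^ 2 * ‖G‖ ^ 2 * ε ≤ c →
            HasForwardError A m K G (C * (d + 1) ^ 2 * √η⁻¹ * ‖G‖ ^ 2 * ε)) := by
  refine ⟨5000, 1 / 10000, by norm_num, by norm_num, fun d ε A m => ⟨fun K G hK => ⟨?_, ?_⟩, ?_⟩⟩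
  · exact fun hε hG => norm_computedL_mul_computedH_sq_sub_le A m hε hK hG
  · exact fun η hlower hupper hsmall => hasForwardError A m hK hlower hupper hsmall
  · rintro η f P hη hf hP _ _ _ rfl rfl rfl hsmall
    exact hasForwardError_one_add_lowerToeplitz_pVec hη hf hP hsmall

theorem theorem3 :
    ∃ C c : ℝ, 0 < C ∧ 0 < c ∧
      ∀ (d : ℕ) (ε : ℝ) (A : FloatArith ε) (m : QRMethod), 1 ≤ d →
        -- arbitrary generators
        (∀ (K : Matrix (Fin (d + 1)) (Fin (d + 1)) ℝ) (G : Matrix (Fin (d + 1)) (Fin 2) ℝ),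
          K - lowerShift d * K * (lowerShift d)ᵀ = G * Gᵀ →
            -- backward error
            ((d : ℝ) * ε ≤ c → NoBreakdown A m G →
              ‖computedL A m G * computedH A m G ^ 2 * (computedL A m G)ᵀ - K‖
                ≤ C * (d : ℝ) ^ 3 * ‖G‖ ^ 2 * ε) ∧
            -- forward error, for spectrum of `K` in `[1, η⁻¹]`
            (∀ η : ℝ, 0 < η → (K - 1).PosSemidef → (η⁻¹ • 1 - K).PosSemidef →
              (d : ℝ) ^ 3 * ‖G‖ ^ 2 * ε ≤ c * Real.sqrt η →
                NoBreakdown A m G ∧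
                ∀ (L : Matrix (Fin (d + 1)) (Fin (d + 1)) ℝ) (δ : Fin (d + 1) → ℝ), IsLDL K L δ →
                  ‖computedL A m G - L‖ ≤ C * (d : ℝ) ^ 3 * η⁻¹ * ‖G‖ ^ 2 * ε)) ∧
        -- forward error for the matrix `K = I + B Bᵀ` of a target polynomial in `S_η`
        (∀ (η : ℝ) (f : Polynomial ℝ) (P : Polynomial ℂ), 0 < η → η < 1 →
          IsTarget d η f → IsOuterComplement f P →
          ∀ (B K : Matrix (Fin (d + 1)) (Fin (d + 1)) ℝ) (G : Matrix (Fin (d + 1)) (Fin 2) ℝ),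
            B = lowerToeplitz (pVec d f P) → K = 1 + B * Bᵀ →
            G = startGenerator (pVec d f P) →
            (d : ℝ) ^ 3 * ‖G‖ ^ 2 * ε ≤ c * Real.sqrt η →
              NoBreakdown A m G ∧
              ∀ (L : Matrix (Fin (d + 1)) (Fin (d + 1)) ℝ) (δ : Fin (d + 1) → ℝ), IsLDL K L δ →
                ‖computedL A m G - L‖ ≤ C * (d : ℝ) ^ 3 * η⁻¹ * ‖G‖ ^ 2 * ε) := by
  obtain ⟨C, c, hC, hc, h⟩ := theorem3_general
  refine ⟨4 * C, c / 4, by positivity, by positivity, fun d ε A m hd =>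
    ⟨fun K G hK => ⟨fun hε hG => ?_, fun η hη hlower hupper hsmall => ?_⟩, ?_⟩⟩
  · refine (((h d ε A m).1 K G hK).1 ?_ hG).trans (backward_bound_le hd hC.le A.nonneg)
    have hd1 : (1 : ℝ) ≤ d := by exact_mod_cast hd
    nlinarith [mul_nonneg (sub_nonneg.2 hd1) A.nonneg]
  · exact HasForwardError.of_sharp hd hC.le hc.le hη
      ((one_le_inv₀ hη).1 (one_le_of_spectrum hlower hupper))
      (((h d ε A m).1 K G hK).2 η hlower hupper) hsmall
  · intro η f P hη hη1 hf hP B K G hB hK hG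
    exact HasForwardError.of_sharp hd hC.le hc.le hη hη1.le
      ((h d ε A m).2 η f P hη hf hP B K G hB hK hG)
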